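/- Let $n\in\mathbb N$, $[n]=\{1,\dots,n\}$, and let $G^\star$ be a directed graph on $[n]$ (directed cycles allowed). **Graph notions.** In a directed graph $G=([n],E)$, $a$ is an *ancestor* of $b$ (and $b$ a *descendant* of $a$) if there is a directed path, possibly of length $0$, from $a$ to $b$. Distinct vertices $a,b$ are *p-adjacent* if there is an edge between them or they have a common child that is an ancestor of $a$ or of $b$. Vertices $a\ne b$ are *d-connected* given $Z\subseteq[n]\setminus\{a,b\}$ if there is a path from $a$ to $b$ (distinct vertices, edges of either direction) on which every collider has a descendant in $Z$ and no other inner vertex is in $Z$. For pairwise disjoint $A,B,Z$, $A\perp B\mid Z$ in $G$ (*d-separation*) if no $a\in A$, $b\in B$ are d-connected given $Z$. Two graphs on $[n]$ are *Markov equivalent* if they satisfy the same d-separation statements. Below, $\perp$ without mention of a graph is d-separation in $G^\star$ (equivalently, conditional independence in a distribution that is Markov and faithful to $G^\star$). **Partially ordered partitions.** Let $\mathcal S$ be the set of pairs $(\mathcal P,\pi)$ of a partition $\mathcal P$ of $[n]$ and a partial order $\leq_\pi$ on $\mathcal P$; $C_a$ is the section containing $a$, and $C\leq_\pi\max\{C_1,\dots,C_k\}$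 means $C\leq_\pi C_i$ for some $i$. For $S\subseteq[n]$ let $\downarrow S=\bigcup\{C\in\mathcal P: C\leq_\pi C_x\text{ for some }x\in S\}$. The partially ordered partition *associated with* $G$ consists of the strongly connected components of $G$, with $C_1\le C_2$ iff $C_1=C_2$ or there is a directed path from any vertex of $C_1$ to any vertex of $C_2$. For $(\mathcal P,\pi)\in\mathcal S$ define - $E^{(1)}=\{(a,b): a\neq b,\ a\not\perp b\mid {\downarrow}\{a,b\}\setminus\{a,b\}\}$; - $E^{(2)}$: the triples $(a,b,c)$ of distinct vertices with $(a,b),(c,b)\in E^{(1)}$, $(a,c)\notin E^{(1)}$, $C_b\leq_\pi\max\{C_a,C_c\}$; - $E^{(3)}$: the triples $(a,b,c)$ of distinct vertices with $(a,b),(c,b)\in E^{(1)}$, $(a,c)\notin E^{(1)}$, $a\not\perp c\mid{\downarrow}\{a,b,c\}\setminus\{a,c\}$; - $E^{(4)}$: the pairs $((a,b_1,c),(a,b_2,c))$, with $a,b_1,c$ distinct and $a,b_2,c$ distinct, such that $(a,b_i),(c,b_i)\in E^{(1)}$ and $(a,b_i,c)\notin E^{(2)}\cup E^{(3)}$ for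 $i=1,2$, $(a,c)\notin E^{(1)}$, and $C_{b_1}\leq_\pi C_{b_2}$; - $D^{(t)}$ ($t\geq1$): the tuples $(a_0,\dots,a_{t+1})$ of distinct vertices with $(a_i,a_{i+1})\in E^{(1)}$ for $0\le i\le t$, $(a_i,a_j)\notin E^{(1)}$ whenever $0\le j\leq i-2\le t-1$, $C_{a_1}=\dots=C_{a_t}$, and $C_{a_1}\not\leq_\pi\max\{C_{a_0},C_{a_{t+1}}\}$; - $E^{(6)}$: the pairs $((a_0,\dots,a_{t+1}),(a_0,b,a_{t+1}))$, $1\leq t\leq n-2$, with $a_0,b,a_{t+1}$ distinct, $(a_0,b),(a_{t+1},b)\in E^{(1)}$, $(a_0,b,a_{t+1})\notin E^{(2)}\cup E^{(3)}$, $(a_0,\dots,a_{t+1})\in D^{(t)}$, and $C_{a_1}\leq_\pi C_b$. Let $S_1=\arg\min_{\mathcal S}|E^{(1)}|$, $S_i=\arg\min_{S_{i-1}}|E^{(i)}|$ for $i=2,3,4$, $S_5^{(1)}=S_4$, $S_5^{(t)}=\arg\max_{S_5^{(t-1)}}|D^{(t)}|$ for $2\leq t\leq n-2$, and $S_6=\arg\min_{S_5^{(n-2)}}|E^{(6)}|$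 (with $S_5^{(n-2)}:=S_4$ if $n\leq 2$). **Theorem.** Let $(\mathcal P,\pi)\in S_6$, and let $G=([n],E)$ be a directed graph such that 1. for all $a,b$: $a$ and $b$ are p-adjacent in $G$ iff $(a,b)\in E^{(1)}$; 2. for all $a,b$: $a$ is an ancestor of $b$ in $G$ iff $C_a\leq_\pi C_b$; 3. if $(a,b,c)\in E^{(3)}$, and $(a,b',c)\notin E^{(3)}$ for all $b'$ with $C_{b'}\leq_\pi C_b$ and $C_{b'}\neq C_b$, then $a$ and $c$ have a common child in $C_b$ in $G$; 4. if $a\neq c$, $(a,b),(c,b)\in E^{(1)}$, $(a,c)\notin E^{(1)}$, $C_b\not\leq_\pi\max\{C_a,C_c\}$, and $(a,b,c)\notin E^{(3)}$, then $a$ and $c$ have no common child in $C_b$ in $G$. Then $G$ is Markov equivalent to $G^\star$. Moreover, $G=G^\star$ satisfies 1–4 with respect to the partially ordered partition associated with $G^\star$. -/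

import Mathlib

namespace CyclicCausal

/-! ### Directed graphs -/

section Graph

variable {V : Type*}

/-- `a` is an ancestor of `b` (and `b` a descendant of `a`): there is a directed path, possibly of
length zero, from `a` to `b`. -/
def IsAncestor (G : Digraph V) (a b : V) : Prop := Relation.ReflTransGen G.Adj a b

/-- `d` is a common child of `a` and `b`. -/
def IsCommonChild (G : Digraph V) (a b d : V) : Prop := G.Adj a d ∧ G.Adj b d

/-- Two (distinct) vertices are p-adjacent if there is an edge between them, or if they have a
common child which is an ancestor of one of them. -/
def PAdj (G : Digraph V) (a b : V) : Prop :=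
  a ≠ b ∧ ((G.Adj a b ∨ G.Adj b a) ∨
    ∃ d, IsCommonChild G a b d ∧ (IsAncestor G d a ∨ IsAncestor G d b))

/-- `a` and `b` are d-connected given `Z`: there is a path `v 0 = a, …, v m = b` of distinct
vertices, with a chosen edge `v i → v (i+1)` (if `fwd i` is true) or `v (i+1) → v i` (if `fwd i`
is false) between any two consecutive ones, such that every collider on the path has a
descendant in `Z` (possibly itself) and no other inner vertex lies in `Z`. -/
def DConnected (G : Digraph V) (a b : V) (Z : Set V) : Prop :=
  ∃ (m : ℕ) (v : ℕ → V) (fwd : ℕ → Bool),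
    v 0 = a ∧ v m = b ∧ Set.InjOn v (Set.Iic m) ∧
    (∀ i < m, (fwd i = true → G.Adj (v i) (v (i + 1))) ∧
      (fwd i = false → G.Adj (v (i + 1)) (v i))) ∧
    (∀ i, i + 1 < m →
      ((fwd i = true ∧ fwd (i + 1) = false) → ∃ z ∈ Z, IsAncestor G (v (i + 1)) z) ∧
      (¬ (fwd i = true ∧ fwd (i + 1) = false) → v (i + 1) ∉ Z))

/-- `A` and `B` are d-separated by `Z` in `G` (meant for pairwise disjoint `A`, `B`, `Z`). -/
def DSep (G : Digraph V) (A B Z : Set V) : Prop :=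
  ∀ a ∈ A, ∀ b ∈ B, ¬ DConnected G a b Z

/-- Two directed graphs on the same vertices are Markov equivalent if they satisfy the same
d-separation statements. -/
def MarkovEquivalent (G H : Digraph V) : Prop :=
  ∀ A B Z : Set V, Disjoint A B → Disjoint A Z → Disjoint B Z → (DSep G A B Z ↔ DSep H A B Z)

end Graph

/-! ### Partially ordered partitions -/

/-- A partition of the vertex set (into nonempty sections) with a partial order on the set of
its sections. -/
structure POPartition (n : ℕ) where
  /-- the partition -/
  partition : Finpartition (Finset.univ : Finset (Fin n))
  /-- the partial order on the sections -/
  le : partition.parts → partition.parts → Prop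
  le_refl : ∀ C, le C C
  le_trans : ∀ C₁ C₂ C₃, le C₁ C₂ → le C₂ C₃ → le C₁ C₃
  le_antisymm : ∀ C₁ C₂, le C₁ C₂ → le C₂ C₁ → C₁ = C₂

/-- The section containing the vertex `a`. -/
def POPartition.sec {n : ℕ} (P : POPartition n) (a : Fin n) : P.partition.parts :=
  ⟨P.partition.part a, P.partition.part_mem.2 (Finset.mem_univ a)⟩

/-- The relation `C_a ≤ max {C_b, C_c}`, i.e. `C_a ≤ C_b` or `C_a ≤ C_c`. -/
def POPartition.LeMax {n : ℕ} (P : POPartition n) (a b c : Fin n) : Prop :=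
  P.le (P.sec a) (P.sec b) ∨ P.le (P.sec a) (P.sec c)

/-- The equivalence relation whose classes are the strongly connected components of `G`. -/
def strongSetoid {n : ℕ} (G : Digraph (Fin n)) : Setoid (Fin n) where
  r i j := IsAncestor G i j ∧ IsAncestor G j i
  iseqv :=
    { refl := fun _ => ⟨Relation.ReflTransGen.refl, Relation.ReflTransGen.refl⟩
      symm := fun h => ⟨h.2, h.1⟩
      trans := fun h k => ⟨h.1.trans k.1, k.2.trans h.2⟩ }

open Classical in
/-- The partition of the vertices into the strongly connected components of `G`. -/
noncomputable def strongComponents {n : ℕ} (G : Digraph (Fin n)) :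
    Finpartition (Finset.univ : Finset (Fin n)) :=
  Finpartition.ofSetoid (strongSetoid G)

theorem mem_strongComponents_rel {n : ℕ} (G : Digraph (Fin n)) {C : Finset (Fin n)}
    (hC : C ∈ (strongComponents G).parts) {x y : Fin n} (hx : x ∈ C) :
    y ∈ C ↔ IsAncestor G x y ∧ IsAncestor G y x := by
  classical
  have h : C = (strongComponents G).part x := ((strongComponents G).part_eq_of_mem hC hx).symm
  subst h
  unfold strongComponents
  rw [Finpartition.mem_part_ofSetoid_iff_rel]
  rfl

/-- The partially ordered partition associated with `G`: the strongly connected components, with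
`C₁ ≤ C₂` if `C₁ = C₂` or there is a directed path from any vertex of `C₁` to any vertex
of `C₂`. -/
noncomputable def assocPOPartition {n : ℕ} (G : Digraph (Fin n)) : POPartition n where
  partition := strongComponents G
  le C₁ C₂ := C₁ = C₂ ∨ ∀ x ∈ C₁.1, ∀ y ∈ C₂.1, IsAncestor G x y
  le_refl _ := Or.inl rfl
  le_trans := by
    rintro C₁ C₂ C₃ (rfl | h) (rfl | k)
    · exact Or.inl rfl
    · exact Or.inr k
    · exact Or.inr h
    · obtain ⟨y, hy⟩ := (strongComponents G).nonempty_of_mem_parts C₂.2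
      exact Or.inr fun x hx z hz => (h x hx y hy).trans (k y hy z hz)
  le_antisymm := by
    rintro C₁ C₂ (rfl | h) (k | k)
    · rfl
    · rfl
    · exact k.symm
    · obtain ⟨x, hx⟩ := (strongComponents G).nonempty_of_mem_parts C₁.2
      obtain ⟨y, hy⟩ := (strongComponents G).nonempty_of_mem_parts C₂.2
      have hxC : x ∈ C₂.1 :=
        (mem_strongComponents_rel G C₂.2 hy).2 ⟨k y hy x hx, h x hx y hy⟩
      exact Subtype.ext ((strongComponents G).eq_of_mem_parts C₁.2 C₂.2 hx hxC)

/-! ### The sets entering the graphical score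

Throughout, `Gs` is the true graph. Conditional independence of the observed variables is
d-separation in `Gs`. -/

section Score

variable {n : ℕ} (Gs : Digraph (Fin n)) (P : POPartition n)

/-- The union of all sections `C` with `C ≤ C_x` for some `x` in the set `S`. -/
def POPartition.down {n : ℕ} (P : POPartition n) (S : Set (Fin n)) : Set (Fin n) :=
  {v | ∃ C : P.partition.parts, (∃ x ∈ S, P.le C (P.sec x)) ∧ v ∈ C.1}

/-- `E⁽¹⁾`. -/
def E1 : Set (Fin n × Fin n) :=
  {p | p.1 ≠ p.2 ∧ ¬ DSep Gs {p.1} {p.2} (P.down {p.1, p.2} \ {p.1, p.2})}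

/-- `E⁽²⁾`. -/
def E2 : Set (Fin n × Fin n × Fin n) :=
  {(a, b, c) | (a ≠ b ∧ b ≠ c ∧ a ≠ c) ∧ (a, b) ∈ E1 Gs P ∧ (c, b) ∈ E1 Gs P ∧
    (a, c) ∉ E1 Gs P ∧ P.LeMax b a c}

/-- `E⁽³⁾`. -/
def E3 : Set (Fin n × Fin n × Fin n) :=
  {(a, b, c) | (a ≠ b ∧ b ≠ c ∧ a ≠ c) ∧ (a, b) ∈ E1 Gs P ∧ (c, b) ∈ E1 Gs P ∧
    (a, c) ∉ E1 Gs P ∧ ¬ DSep Gs {a} {c} (P.down {a, b, c} \ {a, c})}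

/-- `E⁽⁴⁾`. -/
def E4 : Set ((Fin n × Fin n × Fin n) × (Fin n × Fin n × Fin n)) :=
  {q | ∃ a b₁ b₂ c, q = ((a, b₁, c), (a, b₂, c)) ∧
    (a ≠ b₁ ∧ b₁ ≠ c ∧ a ≠ c) ∧ (a ≠ b₂ ∧ b₂ ≠ c ∧ a ≠ c) ∧
    (a, b₁) ∈ E1 Gs P ∧ (c, b₁) ∈ E1 Gs P ∧ (a, b₂) ∈ E1 Gs P ∧ (c, b₂) ∈ E1 Gs P ∧
    (a, c) ∉ E1 Gs P ∧
    (a, b₁, c) ∉ E2 Gs P ∧ (a, b₂, c) ∉ E2 Gs P ∧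
    (a, b₁, c) ∉ E3 Gs P ∧ (a, b₂, c) ∉ E3 Gs P ∧
    P.le (P.sec b₁) (P.sec b₂)}

/-- `D⁽ᵗ⁾`, a set of tuples `(a 0, a 1, …, a (t+1))` (used for `t ≥ 1`). -/
def D (t : ℕ) : Set (Fin (t + 2) → Fin n) :=
  {a | Function.Injective a ∧
    (∀ i : Fin (t + 1), (a i.castSucc, a i.succ) ∈ E1 Gs P) ∧
    (∀ i j : Fin (t + 2), (j : ℕ) + 2 ≤ (i : ℕ) → (a i, a j) ∉ E1 Gs P) ∧
    (∀ i : Fin (t + 2), 1 ≤ (i : ℕ) → (i : ℕ) ≤ t → P.sec (a i) = P.sec (a 1)) ∧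
    ¬ P.LeMax (a 1) (a 0) (a (Fin.last (t + 1)))}

/-- `E⁽⁶⁾`; an element is a triple of `t`, a tuple `(a 0, …, a (t+1))` and `(a 0, b, a (t+1))`,
where `1 ≤ t ≤ n - 2`. -/
def E6 : Set (Σ t : ℕ, (Fin (t + 2) → Fin n) × (Fin n × Fin n × Fin n)) :=
  {q | ∃ (t : ℕ) (a : Fin (t + 2) → Fin n) (b : Fin n),
    q = ⟨t, a, (a 0, b, a (Fin.last (t + 1)))⟩ ∧ 1 ≤ t ∧ t + 2 ≤ n ∧
    (a 0 ≠ b ∧ b ≠ a (Fin.last (t + 1)) ∧ a 0 ≠ a (Fin.last (t + 1))) ∧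
    (a 0, b) ∈ E1 Gs P ∧ (a (Fin.last (t + 1)), b) ∈ E1 Gs P ∧
    (a 0, b, a (Fin.last (t + 1))) ∉ E2 Gs P ∧
    (a 0, b, a (Fin.last (t + 1))) ∉ E3 Gs P ∧
    a ∈ D Gs P t ∧
    P.le (P.sec (a 1)) (P.sec b)}

/-- `E⁽⁶⁾` is finite, so that `Set.ncard` is its number of elements. -/
theorem E6_finite : (E6 Gs P).Finite := by
  have h : (E6 Gs P) ⊆ ⋃ t ∈ Set.Iic n, Set.range
      (fun x : (Fin (t + 2) → Fin n) × (Fin n × Fin n × Fin n) =>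
        (⟨t, x⟩ : Σ t : ℕ, (Fin (t + 2) → Fin n) × (Fin n × Fin n × Fin n))) := by
    rintro q ⟨t, a, b, rfl, -, ht, -⟩
    simp only [Set.mem_iUnion]
    exact ⟨t, by simp only [Set.mem_Iic]; omega, ⟨_, rfl⟩⟩
  exact ((Set.finite_Iic n).biUnion fun t _ => Set.finite_range _).subset h

end Score

/-! ### Successive optimization -/

/-- The minimizers of `f` over `S`. -/
def argmin {α : Type*} (S : Set α) (f : α → ℕ) : Set α := {x ∈ S | ∀ y ∈ S, f x ≤ f y}

/-- The maximizers of `f` over `S`. -/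
def argmax {α : Type*} (S : Set α) (f : α → ℕ) : Set α := {x ∈ S | ∀ y ∈ S, f y ≤ f x}

section Optimal

variable {n : ℕ} (Gs : Digraph (Fin n))

noncomputable def S1 : Set (POPartition n) := argmin Set.univ fun P => (E1 Gs P).ncard

noncomputable def S2 : Set (POPartition n) := argmin (S1 Gs) fun P => (E2 Gs P).ncard

noncomputable def S3 : Set (POPartition n) := argmin (S2 Gs) fun P => (E3 Gs P).ncard

noncomputable def S4 : Set (POPartition n) := argmin (S3 Gs) fun P => (E4 Gs P).ncard

/-- `S₅⁽ᵗ⁾`: it is `S₄` for `t = 1` (and, by convention, for `t = 0`), and the set of maximizers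
of `|D⁽ᵗ⁾|` over `S₅⁽ᵗ⁻¹⁾` for `t ≥ 2`. -/
noncomputable def S5 : ℕ → Set (POPartition n)
  | 0 => S4 Gs
  | 1 => S4 Gs
  | t + 2 => argmax (S5 (t + 1)) fun P => (D Gs P (t + 2)).ncard

/-- The optimal partially ordered partitions: the minimizers of `|E⁽⁶⁾|` over `S₅⁽ⁿ⁻²⁾`. -/
noncomputable def S6 : Set (POPartition n) := argmin (S5 Gs (n - 2)) fun P => (E6 Gs P).ncard

end Optimal

/-! ### The four properties -/

/-- The directed graph `G` has the four properties with respect to the partially ordered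
partition `P`, where `Gs` is the true graph. -/
structure HasProperties {n : ℕ} (Gs : Digraph (Fin n)) (P : POPartition n)
    (G : Digraph (Fin n)) : Prop where
  pAdj_iff : ∀ a b, PAdj G a b ↔ (a, b) ∈ E1 Gs P
  ancestor_iff : ∀ a b, IsAncestor G a b ↔ P.le (P.sec a) (P.sec b)
  commonChild : ∀ a b c, (a, b, c) ∈ E3 Gs P →
    (∀ b', P.le (P.sec b') (P.sec b) → P.sec b' ≠ P.sec b → (a, b', c) ∉ E3 Gs P) →
    ∃ d, d ∈ (P.sec b).1 ∧ IsCommonChild G a c d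
  noCommonChild : ∀ a b c, a ≠ c → (a, b) ∈ E1 Gs P → (c, b) ∈ E1 Gs P → (a, c) ∉ E1 Gs P →
    ¬ P.LeMax b a c → (a, b, c) ∉ E3 Gs P →
    ¬ ∃ d, d ∈ (P.sec b).1 ∧ IsCommonChild G a c d

end CyclicCausal

/-! d-connection of `a` and `b` given `Z` is connectedness outside `Z` in the moral graph on the
ancestors of `a`, `b` and `Z` (`dConnected_iff_moralConn`). To move a shortest moral path from `G`
to `H`, its moral edges must survive and its vertices must stay ancestral in `H`. If some vertices
do not, a stretch of them that is maximal for the ancestral order is a mutual chain: an induced path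
whose inner vertices are equivalent and precede neither end (`exists_isMutualChain`). So two graphs
are Markov equivalent once they agree on p-adjacencies, on unshielded triples below a common child,
on mutual chains, and on which nonconductors descend from a mutual chain
(`Compatible.markovEquivalent`).

The scores encode these data. p-adjacent vertices are never separated, so `E1` of any partition
contains the p-adjacencies of the true graph, and the associated partition attains exactly these.
Each later `E` set of the associated partition lies in that of every competitor agreeing with it so
far: for `E3`, conditioning on a descendant of a common child connects its parents; for the others,
if the competitor lacked an ancestral relation of the true graph, the vertices it leaves out of a
conditioning set would open a path it has to block. For `D` the inclusion is reversed, which is why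
`D` is maximized. Inclusion together with optimal cardinality gives equality, so an optimal
partition shares the relevant sets with the associated one (`S6_spec`), and the four properties
transfer them to `G` (`HasProperties.compatible`). -/

namespace CyclicCausal

/-! ### Induced paths and maximal stretches in a preorder -/

section Paths

variable {V : Type*}

/-- A shortest path for a relation has no chords and no repeated vertices. -/
theorem exists_induced_path {r : V → V → Prop} {a b : V} (h : Relation.ReflTransGen r a b) :
    ∃ (m : ℕ) (v : ℕ → V), v 0 = a ∧ v m = b ∧ (∀ i < m, r (v i) (v (i + 1))) ∧
      (∀ i j, i + 2 ≤ j → j ≤ m → ¬ r (v i) (v j)) ∧ (∀ i j, i < j → j ≤ m → v i ≠ v j) := by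
  classical
  have hex : ∃ (m : ℕ) (v : ℕ → V), v 0 = a ∧ v m = b ∧ ∀ i < m, r (v i) (v (i + 1)) := by
    induction h with
    | refl => exact ⟨0, fun _ => a, rfl, rfl, by simp⟩
    | @tail c d _ hcd ih =>
      obtain ⟨m, v, h0, hm, hv⟩ := ih
      refine ⟨m + 1, fun k => if k ≤ m then v k else d, by simp [h0], by simp, fun i hi => ?_⟩
      rcases Nat.lt_or_ge i m with h | h
      · simpa [h.le, Nat.succ_le_of_lt h] using hv i h
      · obtain rfl : i = m := by omega
        simpa [hm] using hcd
  obtain ⟨v, h0, hm, hv⟩ := Nat.find_spec hex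
  set m := Nat.find hex with hmdef
  have hmin : ∀ k < m, ¬ ∃ v : ℕ → V, v 0 = a ∧ v k = b ∧ ∀ i < k, r (v i) (v (i + 1)) :=
    fun k hk => Nat.find_min hex hk
  refine ⟨m, v, h0, hm, hv, fun i j hij hj hr => ?_, fun i j hij hj he => ?_⟩
  · refine hmin (m - (j - i - 1)) (by omega)
      ⟨fun k => if k ≤ i then v k else v (k + (j - i - 1)), by simp [h0], ?_, fun k hk => ?_⟩
    · have : ¬ m - (j - i - 1) ≤ i := by omega
      simp only [this, if_false]
      rw [← hm]; congr 1; omega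
    · rcases lt_trichotomy k i with h | h | h
      · simpa [h.le, Nat.succ_le_of_lt h] using hv k (by omega)
      · subst h
        have : k + 1 + (j - k - 1) = j := by omega
        simpa [this] using hr
      · have h1 : ¬ k ≤ i := by omega
        have h2 : ¬ k + 1 ≤ i := by omega
        simp only [h1, h2, if_false]
        have := hv (k + (j - i - 1)) (by omega)
        rwa [show k + (j - i - 1) + 1 = k + 1 + (j - i - 1) by omega] at this
  · refine hmin (m - (j - i)) (by omega)
      ⟨fun k => if k ≤ i then v k else v (k + (j - i)), by simp [h0], ?_, fun k hk => ?_⟩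
    · by_cases h : m - (j - i) ≤ i
      · simp only [h, if_true]
        have h1 : j = m := by omega
        have h2 : m - (j - i) = i := by omega
        rw [h2, he, h1, hm]
      · simp only [h, if_false]
        rw [← hm]; congr 1; omega
    · rcases lt_trichotomy k i with h | h | h
      · simpa [h.le, Nat.succ_le_of_lt h] using hv k (by omega)
      · subst h
        have := hv j (by omega)
        have h3 : k + 1 + (j - k) = j + 1 := by omega
        simpa [h3, he] using this
      · have h1 : ¬ k ≤ i := by omega
        have h2 : ¬ k + 1 ≤ i := by omega
        simp only [h1, h2, if_false]
        have := hv (k + (j - i)) (by omega)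
        rwa [show k + (j - i) + 1 = k + 1 + (j - i) by omega] at this

/-- In a sequence whose ends lie in a set `U` that is closed under predecessors, a term outside
`U` forces an interval of equivalent terms outside `U` that precede neither of its two
neighbours. -/
theorem exists_sink_interval {le : V → V → Prop} (hrefl : ∀ x, le x x)
    (htrans : ∀ x y z, le x y → le y z → le x z) {U : Set V}
    (hU : ∀ x y, le x y → y ∈ U → x ∈ U) (x : ℕ → V) {m i : ℕ} (h0 : x 0 ∈ U) (hm : x m ∈ U)
    (him : i ≤ m) (hi : x i ∉ U) :
    ∃ k l, k ≤ l ∧ l + 2 ≤ m ∧ (∀ e, k + 1 ≤ e → e ≤ l + 1 → x e ∉ U) ∧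
      (∀ e, k + 1 ≤ e → e ≤ l + 1 → le (x e) (x (k + 1)) ∧ le (x (k + 1)) (x e)) ∧
      ¬ le (x (k + 1)) (x k) ∧ ¬ le (x (k + 1)) (x (l + 2)) := by
  classical
  -- Fewest terms above `x j` means that its class is maximal: whatever `x j` precedes is again
  -- outside `U`, has no more terms above it, and hence precedes `x j`. The interval then grows from
  -- `j` in both directions while `x j` precedes the terms.
  obtain ⟨j, hj, hjmin⟩ := Finset.exists_min_image
    ((Finset.range (m + 1)).filter fun j => x j ∉ U)
    (fun j => ((Finset.range (m + 1)).filter fun j' => le (x j) (x j')).card)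
    ⟨i, by simp only [Finset.mem_filter, Finset.mem_range]; exact ⟨by omega, hi⟩⟩
  simp only [Finset.mem_filter, Finset.mem_range] at hj hjmin
  obtain ⟨hjm, hjU⟩ := hj
  have hsink : ∀ j', j' ≤ m → le (x j) (x j') → le (x j') (x j) := by
    intro j' hj' hle
    have hsub : ((Finset.range (m + 1)).filter fun e => le (x j') (x e)) ⊆
        (Finset.range (m + 1)).filter fun e => le (x j) (x e) := by
      intro e he
      simp only [Finset.mem_filter, Finset.mem_range] at he ⊢
      exact ⟨he.1, htrans _ _ _ hle he.2⟩
    have heq := Finset.eq_of_subset_of_card_le hsub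
      (hjmin j' ⟨by omega, fun h => hjU (hU _ _ hle h)⟩)
    have : j ∈ (Finset.range (m + 1)).filter fun e => le (x j) (x e) := by
      simp only [Finset.mem_filter, Finset.mem_range]; exact ⟨hjm, hrefl _⟩
    rw [← heq] at this
    simp only [Finset.mem_filter, Finset.mem_range] at this
    exact this.2
  have hn0 : ¬ le (x j) (x 0) := fun h => hjU (hU _ _ h h0)
  have hnm : ¬ le (x j) (x m) := fun h => hjU (hU _ _ h hm)
  have hjne : j ≠ m := by rintro rfl; exact hnm (hrefl _)
  have hright : ∃ e, j + e ≤ m ∧ ¬ le (x j) (x (j + e)) :=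
    ⟨m - j, by omega, by rwa [show j + (m - j) = m by omega]⟩
  have hleft : ∃ e, e ≤ j ∧ ¬ le (x j) (x (j - e)) := ⟨j, le_rfl, by simpa using hn0⟩
  obtain ⟨hr1, hr2⟩ := Nat.find_spec hright
  obtain ⟨hl1, hl2⟩ := Nat.find_spec hleft
  have hrmin : ∀ e < Nat.find hright, le (x j) (x (j + e)) := by
    intro e he
    have := Nat.find_min hright he
    by_contra hc
    exact this ⟨by omega, hc⟩
  have hlmin : ∀ e < Nat.find hleft, le (x j) (x (j - e)) := by
    intro e he
    have := Nat.find_min hleft he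
    by_contra hc
    exact this ⟨by omega, hc⟩
  generalize Nat.find hright = R at *
  generalize Nat.find hleft = L at *
  have hR : R ≠ 0 := by rintro rfl; exact hr2 (hrefl _)
  have hL : L ≠ 0 := by rintro rfl; exact hl2 (hrefl _)
  have hin : ∀ e, j - L + 1 ≤ e → e ≤ j + R - 1 → le (x j) (x e) ∧ le (x e) (x j) := by
    intro e h1 h2
    have : le (x j) (x e) := by
      rcases le_total e j with h | h
      · have := hlmin (j - e) (by omega)
        rwa [show j - (j - e) = e by omega] at this
      · have := hrmin (e - j) (by omega)
        rwa [show j + (e - j) = e by omega] at this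
    exact ⟨this, hsink e (by omega) this⟩
  obtain ⟨hk1, hk2⟩ := hin (j - L + 1) (by omega) (by omega)
  refine ⟨j - L, j + R - 2, by omega, by omega, fun e h1 h2 => ?_, fun e h1 h2 => ?_,
    fun h => hl2 (htrans _ _ _ hk1 h), fun h => hr2 ?_⟩
  · exact fun h => hjU (hU _ _ (hin e h1 (by omega)).1 h)
  · obtain ⟨h3, h4⟩ := hin e h1 (by omega)
    exact ⟨htrans _ _ _ h4 hk1, htrans _ _ _ hk2 h3⟩
  · have := htrans _ _ _ hk1 h
    rwa [show j + R - 2 + 2 = j + R by omega] at this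

end Paths

/-! ### The moral graph criterion for d-connection -/

section Moral

variable {V : Type*} {G : Digraph V} {a b : V} {Z : Set V}

theorem PAdj.symm {a b : V} (h : PAdj G a b) : PAdj G b a := by
  obtain ⟨h1, h2 | ⟨d, h3, h4⟩⟩ := h
  · exact ⟨h1.symm, Or.inl h2.symm⟩
  · exact ⟨h1.symm, Or.inr ⟨d, h3.symm, h4.symm⟩⟩

/-- The ancestors of `a`, `b` and of the elements of `Z`. -/
def ancestralSet (G : Digraph V) (a b : V) (Z : Set V) : Set V :=
  {v | IsAncestor G v a ∨ IsAncestor G v b ∨ ∃ z ∈ Z, IsAncestor G v z}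

theorem ancestralSet_of_isAncestor {x y : V} (h : IsAncestor G x y)
    (hy : y ∈ ancestralSet G a b Z) : x ∈ ancestralSet G a b Z := by
  rcases hy with h1 | h1 | ⟨z, hz, h1⟩
  · exact Or.inl (h.trans h1)
  · exact Or.inr (Or.inl (h.trans h1))
  · exact Or.inr (Or.inr ⟨z, hz, h.trans h1⟩)

/-- Adjacency outside `Z` in the moral graph of the subgraph induced by `W`. -/
def MoralStep (G : Digraph V) (W Z : Set V) (x y : V) : Prop :=
  x ∉ Z ∧ y ∉ Z ∧ x ∈ W ∧ y ∈ W ∧ (PAdj G x y ∨ ∃ d ∈ W, IsCommonChild G x y d)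

/-- `a` and `b` are connected outside `Z` in the moral graph of the subgraph of the ancestors of
`a`, `b` and `Z`. -/
def MoralConn (G : Digraph V) (a b : V) (Z : Set V) : Prop :=
  Relation.ReflTransGen (MoralStep G (ancestralSet G a b Z) Z) a b

/-- A walk that satisfies the conditions of d-connection, apart from distinctness. -/
structure IsOpenWalk (G : Digraph V) (Z : Set V) (m : ℕ) (v : ℕ → V) (fwd : ℕ → Bool) :
    Prop where
  fwd_adj : ∀ i < m, fwd i = true → G.Adj (v i) (v (i + 1))
  bwd_adj : ∀ i < m, fwd i = false → G.Adj (v (i + 1)) (v i)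
  collider : ∀ i, i + 1 < m → fwd i = true → fwd (i + 1) = false →
    ∃ z ∈ Z, IsAncestor G (v (i + 1)) z
  noncollider : ∀ i, i + 1 < m → ¬ (fwd i = true ∧ fwd (i + 1) = false) → v (i + 1) ∉ Z

theorem dConnected_iff_openWalk : DConnected G a b Z ↔
    ∃ m v fwd, v 0 = a ∧ v m = b ∧ Set.InjOn v (Set.Iic m) ∧ IsOpenWalk G Z m v fwd := by
  constructor
  · rintro ⟨m, v, fwd, h0, hm, hi, he, hc⟩
    exact ⟨m, v, fwd, h0, hm, hi, fun i h => (he i h).1, fun i h => (he i h).2,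
      fun i h h1 h2 => (hc i h).1 ⟨h1, h2⟩, fun i h => (hc i h).2⟩
  · rintro ⟨m, v, fwd, h0, hm, hi, hw⟩
    exact ⟨m, v, fwd, h0, hm, hi, fun i h => ⟨hw.fwd_adj i h, hw.bwd_adj i h⟩,
      fun i h => ⟨fun h1 => hw.collider i h h1.1 h1.2, hw.noncollider i h⟩⟩

namespace IsOpenWalk

variable {m : ℕ} {v : ℕ → V} {fwd : ℕ → Bool}

/-- A vertex left forwards is an ancestor of `Z`, or all later edges are forward edges that lead
from it to the end. -/
theorem forward (h : IsOpenWalk G Z m v fwd) {i : ℕ} (hi : fwd i = true) :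
    ∀ k, i + k < m → (∃ z ∈ Z, IsAncestor G (v i) z) ∨
      (fwd (i + k) = true ∧ IsAncestor G (v i) (v (i + k + 1))) := by
  intro k
  induction k with
  | zero => exact fun hk => Or.inr ⟨hi, .single (h.fwd_adj i hk hi)⟩
  | succ k ih =>
    intro hk
    rcases ih (by omega) with h1 | ⟨h1, h2⟩
    · exact Or.inl h1
    · cases h3 : fwd (i + k + 1) with
      | true => exact Or.inr ⟨rfl, h2.tail (h.fwd_adj _ hk h3)⟩
      | false =>
        obtain ⟨z, hz, h4⟩ := h.collider _ hk h1 h3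
        exact Or.inl ⟨z, hz, h2.trans h4⟩

theorem backward (h : IsOpenWalk G Z m v fwd) : ∀ i < m, fwd i = false →
    IsAncestor G (v (i + 1)) (v 0) ∨ ∃ z ∈ Z, IsAncestor G (v (i + 1)) z := by
  intro i
  induction i with
  | zero => exact fun hi h0 => Or.inl (.single (h.bwd_adj 0 hi h0))
  | succ i ih =>
    intro hi h1
    have hadj := h.bwd_adj _ hi h1
    cases h2 : fwd i with
    | false =>
      rcases ih (by omega) h2 with h3 | ⟨z, hz, h3⟩
      · exact Or.inl (.head hadj h3)
      · exact Or.inr ⟨z, hz, .head hadj h3⟩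
    | true =>
      obtain ⟨z, hz, h3⟩ := h.collider _ hi h2 h1
      exact Or.inr ⟨z, hz, .head hadj h3⟩

/-- Arrows leaving `v i` along the walk continue until an end or a collider, and colliders lead to
`Z`. If no walk edge leaves `v i`, it is itself a collider or an end. -/
theorem mem_ancestralSet (h : IsOpenWalk G Z m v fwd) {i : ℕ} (hi : i ≤ m) :
    v i ∈ ancestralSet G (v 0) (v m) Z := by
  rcases Nat.lt_or_ge i m with him | him
  · cases hf : fwd i with
    | true =>
      rcases h.forward hf (m - i - 1) (by omega) with h1 | ⟨-, h1⟩
      · exact Or.inr (Or.inr h1)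
      · rw [show i + (m - i - 1) + 1 = m by omega] at h1
        exact Or.inr (Or.inl h1)
    | false =>
      rcases i with _ | i
      · exact Or.inl .refl
      · cases hf' : fwd i with
        | true => exact Or.inr (Or.inr (h.collider i him hf' hf))
        | false =>
          rcases h.backward i (by omega) hf' with h1 | h1
          · exact Or.inl h1
          · exact Or.inr (Or.inr h1)
  · obtain rfl : i = m := by omega
    exact Or.inr (Or.inl .refl)

/-- An open walk meets `Z` only in colliders, whose two neighbours are married in the moral graph.
Two consecutive vertices cannot both be colliders, so skipping those in `Z` leaves a moral path. -/
theorem reflTransGen_moralStep (h : IsOpenWalk G Z m v fwd) (h0 : v 0 ∉ Z)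
    {i : ℕ} (hi : i ≤ m) (hZ : v i ∉ Z) :
    Relation.ReflTransGen (MoralStep G (ancestralSet G (v 0) (v m) Z) Z) (v 0) (v i) := by
  induction i using Nat.strong_induction_on with
  | _ i ih =>
    rcases i with _ | i
    · exact .refl
    · by_cases hZi : v i ∈ Z
      · rcases i with _ | i
        · exact absurd hZi h0
        · have hcol : fwd i = true ∧ fwd (i + 1) = false := by
            by_contra hc
            exact h.noncollider i (by omega) hc hZi
          have hi' : v i ∉ Z := by
            rcases i with _ | i
            · exact h0
            · exact h.noncollider i (by omega) (by simp [hcol.1])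
          exact (ih i (by omega) (by omega) hi').tail ⟨hi', hZ, h.mem_ancestralSet (by omega),
            h.mem_ancestralSet hi, Or.inr ⟨v (i + 1), h.mem_ancestralSet (by omega),
              h.fwd_adj i (by omega) hcol.1, h.bwd_adj (i + 1) (by omega) hcol.2⟩⟩
      · by_cases he : v i = v (i + 1)
        · exact he ▸ ih i (by omega) (by omega) hZi
        · refine (ih i (by omega) (by omega) hZi).tail ⟨hZi, hZ, h.mem_ancestralSet (by omega),
            h.mem_ancestralSet hi, Or.inl ⟨he, Or.inl ?_⟩⟩
          cases hf : fwd i with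
          | true => exact Or.inl (h.fwd_adj i (by omega) hf)
          | false => exact Or.inr (h.bwd_adj i (by omega) hf)

/-- An open walk can be extended by one edge. -/
theorem snoc (h : IsOpenWalk G Z m v fwd) {y : V} {f : Bool}
    (hf : f = true → G.Adj (v m) y) (hb : f = false → G.Adj y (v m))
    (hc : ∀ i, i + 1 = m → fwd i = true → f = false → ∃ z ∈ Z, IsAncestor G (v m) z)
    (hn : ∀ i, i + 1 = m → ¬ (fwd i = true ∧ f = false) → v m ∉ Z) :
    IsOpenWalk G Z (m + 1) (fun k => if k ≤ m then v k else y)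
      (fun k => if k < m then fwd k else f) := by
  constructor
  · intro i hi h1
    rcases Nat.lt_or_ge i m with him | him
    · simp only [him, if_true] at h1
      simpa [him.le, Nat.succ_le_of_lt him] using h.fwd_adj i him h1
    · obtain rfl : i = m := by omega
      simp only [lt_irrefl, if_false] at h1
      simpa using hf h1
  · intro i hi h1
    rcases Nat.lt_or_ge i m with him | him
    · simp only [him, if_true] at h1
      simpa [him.le, Nat.succ_le_of_lt him] using h.bwd_adj i him h1
    · obtain rfl : i = m := by omega
      simp only [lt_irrefl, if_false] at h1
      simpa using hb h1
  · intro i hi h1 h2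
    have him : i < m := by omega
    simp only [him, if_true] at h1
    simp only [show i + 1 ≤ m by omega, if_true]
    rcases Nat.lt_or_ge (i + 1) m with h3 | h3
    · simp only [h3, if_true] at h2
      exact h.collider i h3 h1 h2
    · obtain rfl : i + 1 = m := by omega
      simp only [lt_irrefl, if_false] at h2
      exact hc i rfl h1 h2
  · intro i hi h1
    have him : i < m := by omega
    simp only [him, if_true] at h1
    simp only [show i + 1 ≤ m by omega, if_true]
    rcases Nat.lt_or_ge (i + 1) m with h3 | h3
    · simp only [h3, if_true] at h1
      exact h.noncollider i h3 h1
    · obtain rfl : i + 1 = m := by omega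
      simp only [lt_irrefl, if_false] at h1
      exact hn i rfl h1

/-- An initial segment of an open walk may be dropped. -/
theorem drop (h : IsOpenWalk G Z m v fwd) (j : ℕ) :
    IsOpenWalk G Z (m - j) (fun k => v (k + j)) (fun k => fwd (k + j)) := by
  have e : ∀ i, i + 1 + j = i + j + 1 := fun i => by omega
  constructor <;> intro i hi <;> simp only [e]
  · exact h.fwd_adj _ (by omega)
  · exact h.bwd_adj _ (by omega)
  · exact h.collider _ (by omega)
  · exact h.noncollider _ (by omega)

theorem take (h : IsOpenWalk G Z m v fwd) {i : ℕ} (hi : i ≤ m) : IsOpenWalk G Z i v fwd :=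
  ⟨fun k hk => h.fwd_adj k (by omega), fun k hk => h.bwd_adj k (by omega),
    fun k hk => h.collider k (by omega), fun k hk => h.noncollider k (by omega)⟩

/-- A closed subwalk of an open walk may be cut out. -/
theorem splice (h : IsOpenWalk G Z m v fwd) {i j : ℕ} (hi : 0 < i) (hij : i < j) (hj : j < m)
    (he : v i = v j) :
    IsOpenWalk G Z (m - (j - i)) (fun k => if k ≤ i then v k else v (k + (j - i)))
      (fun k => if k < i then fwd k else fwd (k + (j - i))) := by
  have hv : ∀ k, i ≤ k → (if k ≤ i then v k else v (k + (j - i))) = v (k + (j - i)) := by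
    intro k hk
    split_ifs with h1
    · obtain rfl : k = i := by omega
      rw [he]; congr 1; omega
    · rfl
  have e : ∀ k, k + 1 + (j - i) = k + (j - i) + 1 := fun k => by omega
  have hv' : ∀ k, i ≤ k + 1 → (if k + 1 ≤ i then v (k + 1) else v (k + (j - i) + 1)) =
      v (k + (j - i) + 1) := fun k hk => by simpa only [e] using hv (k + 1) hk
  constructor
  · intro k hk h1
    rcases Nat.lt_or_ge k i with h2 | h2
    · simp only [h2, if_true] at h1
      simpa [h2.le, Nat.succ_le_of_lt h2] using h.fwd_adj k (by omega) h1
    · simp only [h2.not_gt, if_false] at h1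
      simp only [hv k h2, e, hv' k (by omega)]
      exact h.fwd_adj _ (by omega) h1
  · intro k hk h1
    rcases Nat.lt_or_ge k i with h2 | h2
    · simp only [h2, if_true] at h1
      simpa [h2.le, Nat.succ_le_of_lt h2] using h.bwd_adj k (by omega) h1
    · simp only [h2.not_gt, if_false] at h1
      simp only [hv k h2, e, hv' k (by omega)]
      exact h.bwd_adj _ (by omega) h1
  · intro k hk h1 h2
    rcases lt_trichotomy (k + 1) i with h3 | h3 | h3
    · simp only [h3, show k < i by omega, if_true] at h1 h2
      simp only [h3.le, if_true]
      exact h.collider k (by omega) h1 h2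
    · subst h3
      simp only [Nat.lt_succ_self, lt_irrefl, if_true, if_false, le_refl] at h1 h2 ⊢
      rw [show k + 1 + (j - (k + 1)) = j by omega] at h2
      -- The cut may create a collider at `v i`. Either `v i` was one before, or the removed part
      -- leaves it forwards; as edge `j` points backwards, the arrows must meet a collider on the
      -- way, which leads to `Z`.
      cases h4 : fwd (k + 1) with
      | false => exact h.collider k (by omega) h1 h4
      | true =>
        rcases h.forward h4 (j - (k + 1)) (by omega) with h5 | ⟨h5, -⟩
        · exact h5
        · rw [show k + 1 + (j - (k + 1)) = j by omega, h2] at h5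
          cases h5
    · simp only [h3.not_gt, show ¬ k < i by omega, if_false] at h1 h2
      simp only [e, hv' k (by omega)] at h2 ⊢
      exact h.collider _ (by omega) h1 h2
  · intro k hk h1
    rcases lt_trichotomy (k + 1) i with h3 | h3 | h3
    · simp only [h3, show k < i by omega, if_true] at h1
      simp only [h3.le, if_true]
      exact h.noncollider k (by omega) h1
    · subst h3
      simp only [Nat.lt_succ_self, lt_irrefl, if_true, if_false, le_refl] at h1 ⊢
      rw [show k + 1 + (j - (k + 1)) = j by omega] at h1
      intro hZ
      -- A vertex of `Z` is a collider at both of its occurrences, so it remains one after the cut.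
      have h4 : fwd k = true ∧ fwd (k + 1) = false := by
        by_contra hc; exact h.noncollider k (by omega) hc hZ
      have h5 : fwd (j - 1) = true ∧ fwd (j - 1 + 1) = false := by
        by_contra hc
        refine h.noncollider (j - 1) (by omega) hc ?_
        rwa [show j - 1 + 1 = j by omega, ← he]
      rw [show j - 1 + 1 = j by omega] at h5
      exact h1 ⟨h4.1, h5.2⟩
    · simp only [h3.not_gt, show ¬ k < i by omega, if_false] at h1
      simp only [e, hv' k (by omega)] at h1 ⊢
      exact h.noncollider _ (by omega) h1

/-- The ends of an open walk are d-connected. -/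
theorem dConnected (h : IsOpenWalk G Z m v fwd) : DConnected G (v 0) (v m) Z := by
  induction m using Nat.strong_induction_on generalizing v fwd with
  | _ m ih =>
    by_cases hinj : Set.InjOn v (Set.Iic m)
    · exact dConnected_iff_openWalk.2 ⟨m, v, fwd, rfl, rfl, hinj, h⟩
    · have : ∃ i j, i < j ∧ j ≤ m ∧ v i = v j := by
        by_contra hc
        push Not at hc
        refine hinj fun i hi j hj he => ?_
        rcases lt_trichotomy i j with h1 | h1 | h1
        · exact absurd he (hc i j h1 hj)
        · exact h1
        · exact absurd he.symm (hc j i h1 hi)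
      obtain ⟨i, j, hij, hj, he⟩ := this
      rcases Nat.eq_zero_or_pos i with rfl | hi
      · have := ih (m - j) (by omega) (h.drop j)
        rwa [show m - j + j = m by omega, zero_add, ← he] at this
      · rcases Nat.lt_or_ge j m with hjm | hjm
        · have := ih (m - (j - i)) (by omega) (h.splice hi hij hjm he)
          simpa [show ¬ m - (j - i) ≤ i by omega, show m - (j - i) + (j - i) = m by omega]
            using this
        · obtain rfl : j = m := by omega
          have := ih i hij (h.take hij.le)
          rwa [he] at this

end IsOpenWalk

/-- The vertices `x` reached from `a` by an open walk; the flag tells whether the last edge points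
to `x`. -/
inductive OpenReach (G : Digraph V) (a : V) (Z : Set V) : V → Bool → Prop
  -- With flag `false` the starting vertex is never treated as a collider.
  | start : OpenReach G a Z a false
  | tail_out {x y : V} : OpenReach G a Z x false → x ∉ Z → G.Adj x y → OpenReach G a Z y true
  | tail_in {x y : V} : OpenReach G a Z x false → x ∉ Z → G.Adj y x → OpenReach G a Z y false
  | head_out {x y : V} : OpenReach G a Z x true → x ∉ Z → G.Adj x y → OpenReach G a Z y true
  | head_in {x y : V} : OpenReach G a Z x true → (∃ z ∈ Z, IsAncestor G x z) → G.Adj y x →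
      OpenReach G a Z y false

theorem OpenReach.exists_openWalk {x : V} {f : Bool} (h : OpenReach G a Z x f) :
    ∃ m v fwd, v 0 = a ∧ v m = x ∧ (∀ i, i + 1 = m → fwd i = f) ∧ (m = 0 → f = false) ∧
      IsOpenWalk G Z m v fwd := by
  induction h with
  | start =>
    exact ⟨0, fun _ => a, fun _ => false, rfl, rfl, by simp, by simp, by
      constructor <;> intro i hi <;> omega⟩
  | tail_out _ hx hadj ih =>
    obtain ⟨m, v, fwd, h0, hm, hl, -, hw⟩ := ih
    refine ⟨m + 1, _, _, ?_, ?_, ?_, ?_, hw.snoc (y := _) (f := true) (fun _ => hm ▸ hadj)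
      (by simp) (by simp) (fun _ _ _ => hm ▸ hx)⟩ <;> simp [h0]
  | tail_in _ hx hadj ih =>
    obtain ⟨m, v, fwd, h0, hm, hl, -, hw⟩ := ih
    refine ⟨m + 1, _, _, ?_, ?_, ?_, ?_, hw.snoc (y := _) (f := false) (by simp)
      (fun _ => hm ▸ hadj) (fun i hi h1 => ?_) (fun _ _ _ => hm ▸ hx)⟩
    · simp [h0]
    · simp
    · simp
    · simp
    · rw [hl i hi] at h1; cases h1
  | head_out _ hx hadj ih =>
    obtain ⟨m, v, fwd, h0, hm, hl, -, hw⟩ := ih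
    refine ⟨m + 1, _, _, ?_, ?_, ?_, ?_, hw.snoc (y := _) (f := true) (fun _ => hm ▸ hadj)
      (by simp) (by simp) (fun _ _ _ => hm ▸ hx)⟩ <;> simp [h0]
  | head_in _ hx hadj ih =>
    obtain ⟨m, v, fwd, h0, hm, hl, -, hw⟩ := ih
    refine ⟨m + 1, _, _, ?_, ?_, ?_, ?_, hw.snoc (y := _) (f := false) (by simp)
      (fun _ => hm ▸ hadj) (fun _ _ _ _ => hm ▸ hx) (fun i hi h1 => ?_)⟩
    · simp [h0]
    · simp
    · simp
    · simp
    · exact absurd ⟨hl i hi, rfl⟩ h1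

theorem OpenReach.of_isAncestor_start {x : V} (h : IsAncestor G x a)
    (hx : ¬ ∃ z ∈ Z, IsAncestor G x z) : OpenReach G a Z x false := by
  induction h using Relation.ReflTransGen.head_induction_on with
  | refl => exact .start
  | @head x y hxy _ ih =>
    have hy : ¬ ∃ z ∈ Z, IsAncestor G y z := fun ⟨z, hz, h⟩ => hx ⟨z, hz, .head hxy h⟩
    exact .tail_in (ih hy) (fun h => hy ⟨y, h, .refl⟩) hxy

theorem OpenReach.of_isAncestor {x y : V} {f : Bool} (h : OpenReach G a Z x f)
    (hxy : IsAncestor G x y) (hx : ¬ ∃ z ∈ Z, IsAncestor G x z) : ∃ f, OpenReach G a Z y f := by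
  induction hxy using Relation.ReflTransGen.head_induction_on generalizing f with
  | refl => exact ⟨f, h⟩
  | @head x w hxw _ ih =>
    have hw : ¬ ∃ z ∈ Z, IsAncestor G w z := fun ⟨z, hz, h⟩ => hx ⟨z, hz, .head hxw h⟩
    have hxZ : x ∉ Z := fun h => hx ⟨x, h, .refl⟩
    cases f with
    | false => exact ih (.tail_out h hxZ hxw) hw
    | true => exact ih (.head_out h hxZ hxw) hw

/-- From a reached vertex of the ancestral set one can go against an edge, unless `b` is
reached. -/
theorem OpenReach.against {x y : V} {f : Bool} (h : OpenReach G a Z x f)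
    (hf : f = false → x ∉ Z)
    (hx : x ∈ ancestralSet G a b Z) (hb : ¬ ∃ f, OpenReach G a Z b f) (hyx : G.Adj y x) :
    OpenReach G a Z y false := by
  by_cases hZ : ∃ z ∈ Z, IsAncestor G x z
  · cases f with
    | false => exact .tail_in h (hf rfl) hyx
    | true => exact .head_in h hZ hyx
  · have hxZ : x ∉ Z := fun h => hZ ⟨x, h, .refl⟩
    -- Here `x` does not lead to `Z`. If it leads to `a`, it is reached afresh against the arrows of
    -- a directed path to `a`, and so with a tail at `x`; if it leads to `b`, that directed path is
    -- open.
    rcases hx with h1 | h1 | h1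
    · exact .tail_in (.of_isAncestor_start h1 hZ) hxZ hyx
    · exact absurd (h.of_isAncestor h1 hZ) hb
    · exact absurd h1 hZ

theorem OpenReach.along {x y : V} {f : Bool} (h : OpenReach G a Z x f) (hx : x ∉ Z)
    (hxy : G.Adj x y) : OpenReach G a Z y true := by
  cases f with
  | false => exact .tail_out h hx hxy
  | true => exact .head_out h hx hxy

theorem MoralConn.exists_openReach (h : MoralConn G a b Z) : ∃ f, OpenReach G a Z b f := by
  by_contra hb
  have key : ∀ y, Relation.ReflTransGen (MoralStep G (ancestralSet G a b Z) Z) a y →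
      ∃ f, OpenReach G a Z y f := by
    intro y hy
    induction hy with
    | refl => exact ⟨_, .start⟩
    | @tail x y _ hstep ih =>
      obtain ⟨f, hf⟩ := ih
      obtain ⟨hx, hy, hxW, hyW, hadj⟩ := hstep
      have hcc : ∀ d ∈ ancestralSet G a b Z, IsCommonChild G x y d →
          ∃ f, OpenReach G a Z y f := fun d hd hc =>
        ⟨_, OpenReach.against (hf.along hx hc.1) (by simp) hd hb hc.2⟩
      rcases hadj with ⟨-, (h1 | h1) | ⟨d, hd, h1⟩⟩ | ⟨d, hd, hc⟩
      · exact ⟨_, hf.along hx h1⟩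
      · exact ⟨_, hf.against (fun _ => hx) hxW hb h1⟩
      · refine hcc d ?_ hd
        rcases h1 with h1 | h1
        · exact ancestralSet_of_isAncestor h1 hxW
        · exact ancestralSet_of_isAncestor h1 hyW
      · exact hcc d hd hc
  exact hb (key b h)

/-- The moral graph criterion. -/
theorem dConnected_iff_moralConn (ha : a ∉ Z) (hb : b ∉ Z) :
    DConnected G a b Z ↔ MoralConn G a b Z := by
  constructor
  · rw [dConnected_iff_openWalk]
    rintro ⟨m, v, fwd, rfl, rfl, -, hw⟩
    exact hw.reflTransGen_moralStep ha le_rfl hb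
  · intro h
    obtain ⟨f, hf⟩ := h.exists_openReach
    obtain ⟨m, v, fwd, rfl, rfl, -, -, hw⟩ := hf.exists_openWalk
    exact hw.dConnected

theorem not_dSep_singleton_iff (ha : a ∉ Z) (hb : b ∉ Z) :
    ¬ DSep G {a} {b} Z ↔ MoralConn G a b Z := by
  rw [← dConnected_iff_moralConn ha hb]
  simp [DSep]

end Moral

/-! ### A sufficient condition for Markov equivalence -/

section Compatible

variable {V : Type*}

/-- The terms `x 0, …, x (t + 1)` form an induced path for `adj` whose inner terms are equivalent
for the preorder `le` and precede neither end. -/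
structure IsMutualChain (adj le : V → V → Prop) (t : ℕ) (x : ℕ → V) : Prop where
  ne : ∀ i j, i < j → j ≤ t + 1 → x i ≠ x j
  adj_succ : ∀ i ≤ t, adj (x i) (x (i + 1))
  not_adj : ∀ i j, i + 2 ≤ j → j ≤ t + 1 → ¬ adj (x i) (x j)
  equiv : ∀ i, 1 ≤ i → i ≤ t → le (x i) (x 1) ∧ le (x 1) (x i)
  not_le_left : ¬ le (x 1) (x 0)
  not_le_right : ¬ le (x 1) (x (t + 1))

/-- An induced path with ends in `U` and a term outside `U` contains a mutual chain with inner
terms outside `U`. -/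
theorem exists_isMutualChain {adj le : V → V → Prop} (hrefl : ∀ x, le x x)
    (htrans : ∀ x y z, le x y → le y z → le x z) {U : Set V}
    (hU : ∀ x y, le x y → y ∈ U → x ∈ U) (x : ℕ → V) {m i : ℕ} (h0 : x 0 ∈ U) (hm : x m ∈ U)
    (him : i ≤ m) (hi : x i ∉ U)
    (hne : ∀ i j, i < j → j ≤ m → x i ≠ x j)
    (hadj : ∀ i < m, x i ∉ U ∨ x (i + 1) ∉ U → adj (x i) (x (i + 1)))
    (hnadj : ∀ i j, i + 2 ≤ j → j ≤ m → ¬ adj (x i) (x j)) :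
    ∃ k t, 1 ≤ t ∧ k + t + 1 ≤ m ∧ (∀ e, 1 ≤ e → e ≤ t → x (k + e) ∉ U) ∧
      IsMutualChain adj le t (fun e => x (k + e)) := by
  obtain ⟨k, l, hkl, hlm, hout, heq, hl, hr⟩ :=
    exists_sink_interval hrefl htrans hU x h0 hm him hi
  refine ⟨k, l + 1 - k, by omega, by omega, fun e h1 h2 => hout _ (by omega) (by omega), ?_⟩
  constructor
  · exact fun i j h1 h2 => hne _ _ (by omega) (by omega)
  · intro e he
    refine hadj (k + e) (by omega) ?_
    rcases Nat.eq_zero_or_pos e with rfl | h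
    · exact Or.inr (hout _ (by omega) (by omega))
    · exact Or.inl (hout _ (by omega) (by omega))
  · exact fun i j h1 h2 => hnadj _ _ (by omega) (by omega)
  · exact fun e h1 h2 => heq _ (by omega) (by omega)
  · exact hl
  · have : k + (l + 1 - k + 1) = l + 2 := by omega
    simpa only [this] using hr

/-- `b` is a descendant of a common child of `a` and `c`. -/
def BelowCommonChild (G : Digraph V) (a b c : V) : Prop :=
  ∃ d, IsCommonChild G a c d ∧ IsAncestor G d b

theorem BelowCommonChild.trans {G : Digraph V} {a b b' c : V} (h : BelowCommonChild G a b c)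
    (hb : IsAncestor G b b') : BelowCommonChild G a b' c :=
  let ⟨d, h1, h2⟩ := h
  ⟨d, h1, h2.trans hb⟩

theorem BelowCommonChild.not_isAncestor {G : Digraph V} {a b c : V}
    (h : BelowCommonChild G a b c) (hne : a ≠ c) (hac : ¬ PAdj G a c) :
    ¬ IsAncestor G b a ∧ ¬ IsAncestor G b c := by
  obtain ⟨d, h1, h2⟩ := h
  exact ⟨fun h => hac ⟨hne, Or.inr ⟨d, h1, Or.inl (h2.trans h)⟩⟩,
    fun h => hac ⟨hne, Or.inr ⟨d, h1, Or.inr (h2.trans h)⟩⟩⟩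

/-- Two graphs agree on p-adjacencies, on the unshielded triples with a common child above the
middle vertex, on mutual chains, and on the ancestral relation between mutual chains and the
remaining unshielded nonconductors. -/
structure Compatible (G H : Digraph V) : Prop where
  pAdj : ∀ a b, PAdj G a b ↔ PAdj H a b
  below : ∀ a b c, a ≠ c → ¬ PAdj G a c → PAdj G a b → PAdj G c b →
    (BelowCommonChild G a b c ↔ BelowCommonChild H a b c)
  chain : ∀ t ≥ 1, ∀ x, IsMutualChain (PAdj G) (IsAncestor G) t x ↔
    IsMutualChain (PAdj H) (IsAncestor H) t x
  ancestor : ∀ t ≥ 1, ∀ x b, IsMutualChain (PAdj G) (IsAncestor G) t x → PAdj G (x 0) b →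
    PAdj G (x (t + 1)) b → ¬ BelowCommonChild G (x 0) b (x (t + 1)) →
    (IsAncestor G (x 1) b ↔ IsAncestor H (x 1) b)

namespace Compatible

variable {G H : Digraph V}

theorem symm (h : Compatible G H) : Compatible H G where
  pAdj a b := (h.pAdj a b).symm
  below a b c hne h1 h2 h3 := by
    simp only [← h.pAdj] at h1 h2 h3
    exact (h.below a b c hne h1 h2 h3).symm
  chain t ht x := (h.chain t ht x).symm
  ancestor t ht x b hx h1 h2 h3 := by
    rw [← h.chain t ht x] at hx
    rw [← h.pAdj] at h1 h2
    rw [← h.below _ _ _ (hx.ne _ _ (by omega) le_rfl) (hx.not_adj _ _ (by omega) le_rfl) h1 h2]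
      at h3
    exact (h.ancestor t ht x b hx h1 h2 h3).symm

/-- The first inner vertex of an induced path that is directed in `G` up to its first edge is in
`H` an ancestor of one of the ends. -/
theorem exists_isAncestor_end (h : Compatible G H) {x₀ e : V} {T : Set V} (hne : x₀ ≠ e)
    (hnadj : ¬ PAdj G x₀ e)
    (hr : Relation.ReflTransGen
      (fun x y => PAdj G x y ∧ (x = x₀ ∨ IsAncestor G x y) ∧ (y ∈ T ∨ y = e)) x₀ e) :
    ∃ x ∈ T, IsAncestor H x x₀ ∨ IsAncestor H x e := by
  obtain ⟨m, v, rfl, rfl, hstep, hind, hinj⟩ := exists_induced_path hr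
  have hm2 : 2 ≤ m := by
    rcases m with _ | _ | m
    · exact absurd rfl hne
    · exact absurd (hstep 0 (by omega)).1 hnadj
    · omega
  have hT : ∀ i, 1 ≤ i → i < m → v i ∈ T := by
    intro i h1 h2
    rcases (hstep (i - 1) (by omega)).2.2 with h3 | h3
    · rwa [show i - 1 + 1 = i by omega] at h3
    · rw [show i - 1 + 1 = i by omega] at h3
      exact absurd h3 (hinj i m h2 le_rfl)
  have hanc : ∀ i, 1 ≤ i → i < m → IsAncestor G (v i) (v (i + 1)) := by
    intro i h1 h2
    exact (hstep i h2).2.1.resolve_left fun h3 => hinj 0 i h1 h2.le h3.symm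
  have hanc' : ∀ i j, 1 ≤ i → i ≤ j → j ≤ m → IsAncestor G (v i) (v j) := by
    intro i j h1 h2
    induction j, h2 using Nat.le_induction with
    | base => exact fun _ => .refl
    | succ j h2 ih => exact fun h3 => (ih (by omega)).trans (hanc j (by omega) (by omega))
  -- The path is directed after its first vertex, so any p-adjacency between its vertices would be a
  -- chord for the relation itself.
  have hnadj' : ∀ i j, i + 2 ≤ j → j ≤ m → ¬ PAdj G (v i) (v j) := by
    intro i j h1 h2 h3
    refine hind i j h1 h2 ⟨h3, ?_, ?_⟩
    · rcases Nat.eq_zero_or_pos i with rfl | h4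
      · exact Or.inl rfl
      · exact Or.inr (hanc' i j h4 (by omega) h2)
    · rcases h2.lt_or_eq with h4 | rfl
      · exact Or.inl (hT j (by omega) h4)
      · exact Or.inr rfl
  by_contra hcon
  push Not at hcon
  obtain ⟨k, t, ht, hkt, -, hchain⟩ := exists_isMutualChain (adj := PAdj H)
    (le := IsAncestor H) (fun _ => .refl) (fun _ _ _ h1 h2 => h1.trans h2)
    (U := {x | IsAncestor H x (v 0) ∨ IsAncestor H x (v m)})
    (fun x y hxy hy => hy.imp (fun h => hxy.trans h) (fun h => hxy.trans h)) v
    (Or.inl .refl) (Or.inr .refl) (i := 1) (by omega)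
    (fun hc => hc.elim (hcon _ (hT 1 le_rfl (by omega))).1 (hcon _ (hT 1 le_rfl (by omega))).2)
    hinj (fun i hi _ => (h.pAdj _ _).1 (hstep i hi).1)
    (fun i j h1 h2 h3 => hnadj' i j h1 h2 ((h.pAdj _ _).2 h3))
  -- The mutual chain of `H` is one of `G`, although in `G` its inner vertices are ancestors of its
  -- right end.
  exact ((h.chain t ht _).2 hchain).not_le_right (hanc' _ _ (by omega) (by omega) (by omega))

/-- A set that leads in `H` to all vertices of a directed walk of `G` so far is used to extend
this to the next vertex, unless it is p-adjacent to `x₀`. -/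
theorem isAncestor_of_walk (h : Compatible G H) {x₀ x₁ y e : V} {T : Set V}
    (hstart : Relation.ReflTransGen
      (fun x y => PAdj G x y ∧ (x = x₀ ∨ IsAncestor G x y) ∧ y ∈ T) x₀ x₁)
    (hwalk : Relation.ReflTransGen (fun x y => PAdj G x y ∧ IsAncestor G x y ∧ y ∈ T) x₁ y)
    (hye : G.Adj y e) (hy : y ≠ e) (hne : x₀ ≠ e) (hnadj : ¬ PAdj G x₀ e)
    (hT : ∀ x ∈ T, ¬ IsAncestor H x x₀) : ∃ x ∈ T, IsAncestor H x e := by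
  have h1 : Relation.ReflTransGen (fun x y => PAdj G x y ∧ (x = x₀ ∨ IsAncestor G x y) ∧
      (y ∈ T ∨ y = e)) x₀ y := by
    refine Relation.ReflTransGen.trans (Relation.ReflTransGen.mono ?_ _ _ hstart)
      (Relation.ReflTransGen.mono ?_ _ _ hwalk)
    · exact fun _ _ h => ⟨h.1, h.2.1, Or.inl h.2.2⟩
    · exact fun _ _ h => ⟨h.1, Or.inr h.2.1, Or.inl h.2.2⟩
  obtain ⟨x, hx, h2⟩ := h.exists_isAncestor_end (T := T) hne hnadj
    (h1.tail ⟨⟨hy, Or.inl (Or.inl hye)⟩, Or.inr (.single hye), Or.inr rfl⟩)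
  exact ⟨x, hx, h2.resolve_left (hT x hx)⟩

/-- Descendants in `G` of a mutual chain are descendants of it in `H`, as long as they are not
below a common child of its ends. -/
theorem isAncestor_of_chain (h : Compatible G H) {t : ℕ} (ht : 1 ≤ t) {x : ℕ → V}
    (hx : IsMutualChain (PAdj G) (IsAncestor G) t x) {y : V} (hy : IsAncestor G (x 1) y)
    (hb : ¬ BelowCommonChild G (x 0) y (x (t + 1))) : IsAncestor H (x 1) y := by
  have hxH := (h.chain t ht x).1 hx
  set T : Set V := {v | IsAncestor H (x 1) v}
  -- The induction also carries the walk to `y` inside `T`: preceded by a chain end that is not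
  -- p-adjacent to the next vertex `e`, it supplies the path needed to show that `T` leads to `e` in
  -- `H`. If both ends are p-adjacent to `e`, the field `ancestor` applies.
  suffices hs : IsAncestor H (x 1) y ∧ Relation.ReflTransGen
      (fun x y => PAdj G x y ∧ IsAncestor G x y ∧ y ∈ T) (x 1) y from hs.1
  have hleft : Relation.ReflTransGen
      (fun u w => PAdj G u w ∧ (u = x 0 ∨ IsAncestor G u w) ∧ w ∈ T) (x 0) (x 1) :=
    .single ⟨hx.adj_succ 0 (by omega), Or.inl rfl, Relation.ReflTransGen.refl⟩
  have hright : ∀ k, k ≤ t → Relation.ReflTransGen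
      (fun u w => PAdj G u w ∧ (u = x (t + 1) ∨ IsAncestor G u w) ∧ w ∈ T)
      (x (t + 1)) (x (t + 1 - k)) := by
    intro k
    induction k with
    | zero => exact fun _ => .refl
    | succ k ih =>
      intro hk
      refine (ih (by omega)).tail ⟨?_, ?_, (hxH.equiv _ (by omega) (by omega)).2⟩
      · have := (hx.adj_succ (t + 1 - (k + 1)) (by omega)).symm
        rwa [show t + 1 - (k + 1) + 1 = t + 1 - k by omega] at this
      · rcases Nat.eq_zero_or_pos k with rfl | h0
        · exact Or.inl rfl
        · exact Or.inr ((hx.equiv _ (by omega) (by omega)).1.trans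
            (hx.equiv _ (by omega) (by omega)).2)
  have hright' := hright t le_rfl
  rw [show t + 1 - t = 1 by omega] at hright'
  induction hy with
  | refl => exact ⟨.refl, .refl⟩
  | @tail y e hxy hye ih =>
    obtain ⟨ih1, ih2⟩ := ih fun h => hb (h.trans (.single hye))
    by_cases hne : y = e
    · exact hne ▸ ⟨ih1, ih2⟩
    have hxe : IsAncestor G (x 1) e := hxy.tail hye
    have key : IsAncestor H (x 1) e := by
      by_cases h0 : PAdj G (x 0) e
      · by_cases h1 : PAdj G (x (t + 1)) e
        · exact (h.ancestor t ht x e hx h0 h1 hb).1 hxe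
        · obtain ⟨u, hu, hu'⟩ := h.isAncestor_of_walk hright' ih2 hye hne
            (by rintro rfl; exact hx.not_le_right hxe) h1
            (fun u hu hu' => hxH.not_le_right (Relation.ReflTransGen.trans hu hu'))
          exact Relation.ReflTransGen.trans hu hu'
      · obtain ⟨u, hu, hu'⟩ := h.isAncestor_of_walk hleft ih2 hye hne
          (by rintro rfl; exact hx.not_le_left hxe) h0
          (fun u hu hu' => hxH.not_le_left (Relation.ReflTransGen.trans hu hu'))
        exact Relation.ReflTransGen.trans hu hu'
    exact ⟨key, ih2.tail ⟨⟨hne, Or.inl (Or.inl hye)⟩, .single hye, key⟩⟩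

/-- Compatible graphs have the same vertices below a common child of `a` and `c`. -/
theorem belowCommonChild (h : Compatible G H) {a b c : V} (hne : a ≠ c) (hac : ¬ PAdj G a c)
    (hb : BelowCommonChild G a b c) : BelowCommonChild H a b c := by
  obtain ⟨d, ⟨had, hcd⟩, hdb⟩ := hb
  have hacH : ¬ PAdj H a c := fun h' => hac ((h.pAdj a c).2 h')
  have hbelow : ∀ e, IsAncestor G d e → BelowCommonChild G a e c := fun e he =>
    ⟨d, ⟨had, hcd⟩, he⟩
  have hda : a ≠ d ∧ c ≠ d := by
    have := (hbelow d .refl).not_isAncestor hne hac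
    exact ⟨by rintro rfl; exact this.1 .refl, by rintro rfl; exact this.2 .refl⟩
  have hpa : PAdj G a d := ⟨hda.1, Or.inl (Or.inl had)⟩
  have hpc : PAdj G c d := ⟨hda.2, Or.inl (Or.inl hcd)⟩
  have hd : BelowCommonChild H a d c := (h.below a d c hne hac hpa hpc).1 (hbelow d .refl)
  -- The argument of `isAncestor_of_chain` with another `T`; its members precede neither `a` nor `c`
  -- in `H`, since these are not p-adjacent.
  set T : Set V := {v | BelowCommonChild H a v c}
  suffices hs : BelowCommonChild H a b c ∧ Relation.ReflTransGen
      (fun x y => PAdj G x y ∧ IsAncestor G x y ∧ y ∈ T) d b from hs.1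
  induction hdb with
  | refl => exact ⟨hd, .refl⟩
  | @tail y e hdy hye ih =>
    obtain ⟨ih1, ih2⟩ := ih
    by_cases hyne : y = e
    · exact hyne ▸ ⟨ih1, ih2⟩
    have hde : IsAncestor G d e := hdy.tail hye
    have hen := (hbelow e hde).not_isAncestor hne hac
    have key : BelowCommonChild H a e c := by
      by_cases h0 : PAdj G a e
      · by_cases h1 : PAdj G c e
        · exact (h.below a e c hne hac h0 h1).1 (hbelow e hde)
        · obtain ⟨u, hu, hu'⟩ := h.isAncestor_of_walk (T := T)
            (.single ⟨hpc, Or.inl rfl, hd⟩) ih2 hye hyne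
            (by rintro rfl; exact hen.2 .refl) h1
            (fun u hu => (BelowCommonChild.not_isAncestor hu hne hacH).2)
          exact BelowCommonChild.trans hu hu'
      · obtain ⟨u, hu, hu'⟩ := h.isAncestor_of_walk (T := T)
          (.single ⟨hpa, Or.inl rfl, hd⟩) ih2 hye hyne
          (by rintro rfl; exact hen.1 .refl) h0
          (fun u hu => (BelowCommonChild.not_isAncestor hu hne hacH).1)
        exact BelowCommonChild.trans hu hu'
    exact ⟨key, ih2.tail ⟨⟨hyne, Or.inl (Or.inl hye)⟩, .single hye, key⟩⟩

/-- A shortest moral path of `G` is one of `H` provided it stays in the ancestral set of `H`.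
Otherwise it contains a mutual chain outside that set. Being induced, the path has no common child
of the chain's ends above `a`, `b` or `Z`, so `isAncestor_of_chain` transfers the descent of the
chain to these vertices from `G` to `H`, a contradiction. -/
theorem moralConn (h : Compatible G H) {a b : V} {Z : Set V} (hG : MoralConn G a b Z) :
    MoralConn H a b Z := by
  obtain ⟨m, v, h0, hm, hstep, hind, hinj⟩ := exists_induced_path hG
  set W := ancestralSet G a b Z
  set W' := ancestralSet H a b Z
  have hnadj : ∀ i j, i + 2 ≤ j → j ≤ m →
      ¬ PAdj G (v i) (v j) ∧ ∀ d ∈ W, ¬ IsCommonChild G (v i) (v j) d := by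
    intro i j h1 h2
    have hi := hstep i (by omega)
    have hj := hstep (j - 1) (by omega)
    rw [show j - 1 + 1 = j by omega] at hj
    have := hind i j h1 h2
    refine ⟨fun h3 => this ⟨hi.1, hj.2.1, hi.2.2.1, hj.2.2.2.1, Or.inl h3⟩, fun d hd h3 =>
      this ⟨hi.1, hj.2.1, hi.2.2.1, hj.2.2.2.1, Or.inr ⟨d, hd, h3⟩⟩⟩
  have hW : ∀ i ≤ m, v i ∈ W := by
    intro i hi
    rcases hi.lt_or_eq with h1 | rfl
    · exact (hstep i h1).2.2.1
    · rw [hm]; exact Or.inr (Or.inl .refl)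
  -- Vertices without a common child in `W` are p-adjacent; the others have one in `W'`.
  have hchild : ∀ i < m, ¬ PAdj G (v i) (v (i + 1)) →
      ∃ d ∈ W', IsCommonChild H (v i) (v (i + 1)) d := by
    intro i hi h1
    obtain ⟨d, hd, hcd⟩ := (hstep i hi).2.2.2.2.resolve_left h1
    have hb : ∀ y, IsAncestor G d y → BelowCommonChild H (v i) y (v (i + 1)) := fun y hy =>
      h.belowCommonChild (hinj i (i + 1) (by omega) (by omega)) h1 ⟨d, hcd, hy⟩
    rcases hd with hd | hd | ⟨z, hz, hd⟩
    · obtain ⟨d', h2, h3⟩ := hb _ hd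
      exact ⟨d', Or.inl h3, h2⟩
    · obtain ⟨d', h2, h3⟩ := hb _ hd
      exact ⟨d', Or.inr (Or.inl h3), h2⟩
    · obtain ⟨d', h2, h3⟩ := hb _ hd
      exact ⟨d', Or.inr (Or.inr ⟨z, hz, h3⟩), h2⟩
  have hW' : ∀ i ≤ m, v i ∈ W' := by
    by_contra hc
    push Not at hc
    obtain ⟨i, hi, hi'⟩ := hc
    obtain ⟨k, t, ht, hkt, hout, hchain⟩ := exists_isMutualChain (adj := PAdj H)
      (le := IsAncestor H) (fun _ => .refl) (fun _ _ _ h1 h2 => h1.trans h2) (U := W')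
      (fun x y hxy hy => ancestralSet_of_isAncestor hxy hy) v
      (by rw [h0]; exact Or.inl .refl) (by rw [hm]; exact Or.inr (Or.inl .refl)) hi hi' hinj
      -- A moral edge through a common child in `W'` has both ends in `W'`, so every step touching
      -- the outside is a p-adjacency.
      (fun i hi hor => by
        rw [← h.pAdj]
        by_contra hc
        obtain ⟨d, hd, hcd⟩ := hchild i hi hc
        exact hor.elim (fun h1 => h1 (ancestralSet_of_isAncestor (.single hcd.1) hd))
          (fun h1 => h1 (ancestralSet_of_isAncestor (.single hcd.2) hd)))
      (fun i j h1 h2 => by rw [← h.pAdj]; exact (hnadj i j h1 h2).1)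
    have hG' := (h.chain t ht _).2 hchain
    have hnb : ∀ y ∈ W, ¬ BelowCommonChild G (v (k + 0)) y (v (k + (t + 1))) := by
      rintro y hy ⟨d, hcd, hdy⟩
      exact (hnadj (k + 0) (k + (t + 1)) (by omega) (by omega)).2 d
        (ancestralSet_of_isAncestor hdy hy) hcd
    have hdesc : ∀ y ∈ W, IsAncestor G (v (k + 1)) y → IsAncestor H (v (k + 1)) y :=
      fun y hy h1 => h.isAncestor_of_chain ht hG' h1 (hnb y hy)
    refine hout 1 le_rfl ht ?_
    rcases hW (k + 1) (by omega) with h1 | h1 | ⟨z, hz, h1⟩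
    · exact Or.inl (hdesc _ (Or.inl .refl) h1)
    · exact Or.inr (Or.inl (hdesc _ (Or.inr (Or.inl .refl)) h1))
    · exact Or.inr (Or.inr ⟨z, hz, hdesc _ (Or.inr (Or.inr ⟨z, hz, .refl⟩)) h1⟩)
  have hreach : ∀ i ≤ m, Relation.ReflTransGen (MoralStep H W' Z) a (v i) := by
    intro i
    induction i with
    | zero => intro _; rw [h0]
    | succ i ih =>
      intro hi
      have hs := hstep i hi
      refine (ih (by omega)).tail ⟨hs.1, hs.2.1, hW' i (by omega), hW' _ hi, ?_⟩
      by_cases h1 : PAdj G (v i) (v (i + 1))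
      · exact Or.inl ((h.pAdj _ _).1 h1)
      · exact Or.inr (hchild i hi h1)
  have := hreach m le_rfl
  rwa [hm] at this

theorem markovEquivalent (h : Compatible G H) : MarkovEquivalent G H := by
  intro A B Z _ hAZ hBZ
  unfold DSep
  refine forall₂_congr fun a ha => forall₂_congr fun b hb => not_congr ?_
  have ha' := hAZ.notMem_of_mem_left ha
  have hb' := hBZ.notMem_of_mem_left hb
  rw [dConnected_iff_moralConn ha' hb', dConnected_iff_moralConn ha' hb']
  exact ⟨h.moralConn, h.symm.moralConn⟩

end Compatible

end Compatible

/-! ### Criteria for connection in the moral graph -/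

section MoralConnection

variable {V : Type*} {G : Digraph V} {a b c : V} {Z : Set V}

theorem MoralConn.of_path {t : ℕ} {x : ℕ → V} (hadj : ∀ i ≤ t, PAdj G (x i) (x (i + 1)))
    (hZ : ∀ i ≤ t + 1, x i ∉ Z)
    (hW : ∀ i, 1 ≤ i → i ≤ t → x i ∈ ancestralSet G (x 0) (x (t + 1)) Z) :
    MoralConn G (x 0) (x (t + 1)) Z := by
  have hW' : ∀ i ≤ t + 1, x i ∈ ancestralSet G (x 0) (x (t + 1)) Z := by
    intro i hi
    rcases Nat.eq_zero_or_pos i with rfl | h1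
    · exact Or.inl .refl
    · rcases hi.lt_or_eq with h2 | rfl
      · exact hW i h1 (by omega)
      · exact Or.inr (Or.inl .refl)
  have : ∀ i ≤ t + 1, Relation.ReflTransGen
      (MoralStep G (ancestralSet G (x 0) (x (t + 1)) Z) Z) (x 0) (x i) := by
    intro i
    induction i with
    | zero => exact fun _ => .refl
    | succ i ih =>
      exact fun hi => (ih (by omega)).tail ⟨hZ i (by omega), hZ _ hi, hW' i (by omega), hW' _ hi,
        Or.inl (hadj i (by omega))⟩
  exact this _ le_rfl

theorem MoralConn.of_pAdj (h : PAdj G a b) (ha : a ∉ Z) (hb : b ∉ Z) : MoralConn G a b Z :=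
  .single ⟨ha, hb, Or.inl .refl, Or.inr (Or.inl .refl), Or.inl h⟩

theorem MoralConn.of_triple (hab : PAdj G a b) (hbc : PAdj G b c) (ha : a ∉ Z) (hb : b ∉ Z)
    (hc : c ∉ Z) (hW : b ∈ ancestralSet G a c Z) : MoralConn G a c Z :=
  .tail (.single ⟨ha, hb, Or.inl .refl, hW, Or.inl hab⟩)
    ⟨hb, hc, hW, Or.inr (Or.inl .refl), Or.inl hbc⟩

theorem MoralConn.of_belowCommonChild (h : BelowCommonChild G a b c) (ha : a ∉ Z) (hc : c ∉ Z)
    (hb : b ∈ Z) : MoralConn G a c Z :=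
  let ⟨d, h1, h2⟩ := h
  .single ⟨ha, hc, Or.inl .refl, Or.inr (Or.inl .refl), Or.inr
    ⟨d, Or.inr (Or.inr ⟨b, hb, h2⟩), h1⟩⟩

/-- Given all their other ancestors, two vertices are connected only by an edge of the moral
graph. -/
theorem MoralConn.pAdj_or_commonChild (h : MoralConn G a b Z) (hne : a ≠ b)
    (hZ : ∀ v ∈ ancestralSet G a b Z, v = a ∨ v = b ∨ v ∈ Z) :
    PAdj G a b ∨ ∃ d ∈ ancestralSet G a b Z, IsCommonChild G a b d := by
  have key : ∀ x, Relation.ReflTransGen (MoralStep G (ancestralSet G a b Z) Z) x b → x = a →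
      PAdj G a b ∨ ∃ d ∈ ancestralSet G a b Z, IsCommonChild G a b d := by
    intro x hx
    induction hx using Relation.ReflTransGen.head_induction_on with
    | refl => exact fun h => absurd h.symm hne
    | head hstep _ ih =>
      rintro rfl
      rcases hZ _ hstep.2.2.2.1 with h1 | rfl | h1
      · exact ih h1
      · exact hstep.2.2.2.2
      · exact absurd h1 hstep.2.1
  exact key a h rfl

end MoralConnection

/-! ### Comparison of a partition with the one associated with the true graph -/

section Partitions

variable {n : ℕ}

/-- The preorder on the vertices that a partially ordered partition induces. -/
def POPartition.vle (P : POPartition n) (a b : Fin n) : Prop := P.le (P.sec a) (P.sec b)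

theorem POPartition.vle_refl (P : POPartition n) (a : Fin n) : P.vle a a := P.le_refl _

theorem POPartition.vle_trans (P : POPartition n) {a b c : Fin n} (h : P.vle a b)
    (k : P.vle b c) : P.vle a c := P.le_trans _ _ _ h k

theorem POPartition.leMax_iff (P : POPartition n) {a b c : Fin n} :
    P.LeMax a b c ↔ P.vle a b ∨ P.vle a c := Iff.rfl

theorem POPartition.sec_eq_iff (P : POPartition n) {a b : Fin n} :
    P.sec a = P.sec b ↔ P.vle a b ∧ P.vle b a := by
  constructor
  · intro h
    unfold POPartition.vle
    rw [h]
    exact ⟨P.le_refl _, P.le_refl _⟩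
  · exact fun h => P.le_antisymm _ _ h.1 h.2

theorem POPartition.mem_iff_sec_eq (P : POPartition n) {a : Fin n} {C : P.partition.parts} :
    a ∈ C.1 ↔ P.sec a = C := by
  constructor
  · exact fun h => Subtype.ext (P.partition.part_eq_of_mem C.2 h)
  · rintro rfl
    exact P.partition.mem_part (Finset.mem_univ a)

theorem POPartition.mem_down (P : POPartition n) {S : Set (Fin n)} {v : Fin n} :
    v ∈ P.down S ↔ ∃ x ∈ S, P.vle v x := by
  constructor
  · rintro ⟨C, ⟨x, hx, hC⟩, hv⟩
    obtain rfl := P.mem_iff_sec_eq.1 hv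
    exact ⟨x, hx, hC⟩
  · rintro ⟨x, hx, h⟩
    exact ⟨P.sec v, ⟨x, hx, h⟩, P.mem_iff_sec_eq.2 rfl⟩

theorem vle_assocPOPartition (G : Digraph (Fin n)) {a b : Fin n} :
    (assocPOPartition G).vle a b ↔ IsAncestor G a b := by
  have hmem : ∀ x, x ∈ ((assocPOPartition G).sec x).1 := fun x =>
    (assocPOPartition G).mem_iff_sec_eq.2 rfl
  constructor
  · rintro (h | h)
    · have : b ∈ ((assocPOPartition G).sec a).1 := h ▸ hmem b
      exact ((mem_strongComponents_rel G ((assocPOPartition G).sec a).2 (hmem a)).1 this).1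
    · exact h a (hmem a) b (hmem b)
  · intro h
    refine Or.inr fun x hx y hy => ?_
    have h1 := ((mem_strongComponents_rel G ((assocPOPartition G).sec a).2 (hmem a)).1 hx).2
    have h2 := ((mem_strongComponents_rel G ((assocPOPartition G).sec b).2 (hmem b)).1 hy).1
    exact (h1.trans h).trans h2

variable {Gs : Digraph (Fin n)} {P : POPartition n} {a b b' c : Fin n}

theorem mem_E1_iff : (a, b) ∈ E1 Gs P ↔
    a ≠ b ∧ MoralConn Gs a b (P.down {a, b} \ {a, b}) := by
  rw [← not_dSep_singleton_iff (by simp) (by simp)]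
  rfl

theorem mem_E1_of_pAdj (h : PAdj Gs a b) : (a, b) ∈ E1 Gs P :=
  mem_E1_iff.2 ⟨h.1, .of_pAdj h (by simp) (by simp)⟩

/-- For the associated partition the conditioning set consists of all other ancestors, so a
connection must be a single moral edge, and a common child used by it is an ancestor of `a` or `b`.
-/
theorem mem_E1_assocPOPartition_iff : (a, b) ∈ E1 Gs (assocPOPartition Gs) ↔ PAdj Gs a b := by
  refine ⟨fun h => ?_, mem_E1_of_pAdj⟩
  obtain ⟨hne, h⟩ := mem_E1_iff.1 h
  have hanc : ∀ v ∈ ancestralSet Gs a b ((assocPOPartition Gs).down {a, b} \ {a, b}),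
      IsAncestor Gs v a ∨ IsAncestor Gs v b := by
    rintro v (h1 | h1 | ⟨z, ⟨hz, -⟩, h1⟩)
    · exact Or.inl h1
    · exact Or.inr h1
    · rw [POPartition.mem_down] at hz
      obtain ⟨x, rfl | rfl, hx⟩ := hz <;> rw [vle_assocPOPartition] at hx
      · exact Or.inl (h1.trans hx)
      · exact Or.inr (h1.trans hx)
  have hZ : ∀ v ∈ ancestralSet Gs a b ((assocPOPartition Gs).down {a, b} \ {a, b}),
      v = a ∨ v = b ∨ v ∈ (assocPOPartition Gs).down {a, b} \ {a, b} := by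
    intro v hv
    by_cases h1 : v = a
    · exact Or.inl h1
    · by_cases h2 : v = b
      · exact Or.inr (Or.inl h2)
      · refine Or.inr (Or.inr ⟨?_, by simp [h1, h2]⟩)
        rw [POPartition.mem_down]
        simpa [vle_assocPOPartition] using hanc v hv
  obtain h1 | ⟨d, hd, h1⟩ := h.pAdj_or_commonChild hne hZ
  · exact h1
  · exact ⟨hne, Or.inr ⟨d, h1, hanc d hd⟩⟩

/-- The partition recovers the p-adjacencies of the true graph. -/
def RecoversPAdj (Gs : Digraph (Fin n)) (P : POPartition n) : Prop :=
  ∀ a b, (a, b) ∈ E1 Gs P ↔ PAdj Gs a b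

theorem recoversPAdj_assocPOPartition (Gs : Digraph (Fin n)) :
    RecoversPAdj Gs (assocPOPartition Gs) := fun _ _ => mem_E1_assocPOPartition_iff

theorem RecoversPAdj.mem_E2_iff (h : RecoversPAdj Gs P) : (a, b, c) ∈ E2 Gs P ↔
    a ≠ c ∧ PAdj Gs a b ∧ PAdj Gs c b ∧ ¬ PAdj Gs a c ∧ (P.vle b a ∨ P.vle b c) := by
  have : (a, b, c) ∈ E2 Gs P ↔ (a ≠ b ∧ b ≠ c ∧ a ≠ c) ∧ (a, b) ∈ E1 Gs P ∧ (c, b) ∈ E1 Gs P ∧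
    (a, c) ∉ E1 Gs P ∧ P.LeMax b a c := Iff.rfl
  rw [this, h, h, h, P.leMax_iff]
  constructor
  · rintro ⟨⟨-, -, h1⟩, h2⟩
    exact ⟨h1, h2⟩
  · rintro ⟨h1, h2, h3, h4⟩
    exact ⟨⟨h2.1, h3.1.symm, h1⟩, h2, h3, h4⟩

theorem RecoversPAdj.mem_E3_iff (h : RecoversPAdj Gs P) : (a, b, c) ∈ E3 Gs P ↔
    a ≠ c ∧ PAdj Gs a b ∧ PAdj Gs c b ∧ ¬ PAdj Gs a c ∧
      MoralConn Gs a c (P.down {a, b, c} \ {a, c}) := by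
  rw [← not_dSep_singleton_iff (by simp) (by simp)]
  have : (a, b, c) ∈ E3 Gs P ↔ (a ≠ b ∧ b ≠ c ∧ a ≠ c) ∧ (a, b) ∈ E1 Gs P ∧ (c, b) ∈ E1 Gs P ∧
    (a, c) ∉ E1 Gs P ∧ ¬ DSep Gs {a} {c} (P.down {a, b, c} \ {a, c}) := Iff.rfl
  rw [this, h, h, h]
  constructor
  · rintro ⟨⟨-, -, h1⟩, h2⟩
    exact ⟨h1, h2⟩
  · rintro ⟨h1, h2, h3, h4⟩
    exact ⟨⟨h2.1, h3.1.symm, h1⟩, h2, h3, h4⟩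

/-- The source of contradictions below: a path avoiding `P.down {a, c}` whose inner vertices are
true ancestors of its ends must not exist. -/
theorem RecoversPAdj.not_moralConn (h : RecoversPAdj Gs P) (hne : a ≠ c) (hac : ¬ PAdj Gs a c) :
    ¬ MoralConn Gs a c (P.down {a, c} \ {a, c}) := fun hc =>
  hac ((h a c).1 (mem_E1_iff.2 ⟨hne, hc⟩))

theorem POPartition.notMem_down_pair (h1 : ¬ P.vle b a) (h2 : ¬ P.vle b c) :
    b ∉ P.down {a, c} \ {a, c} := by
  rintro ⟨h, -⟩
  rw [P.mem_down] at h
  obtain ⟨x, rfl | rfl, hx⟩ := h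
  · exact h1 hx
  · exact h2 hx

theorem POPartition.notMem_down_triple (h1 : ¬ P.vle b' a) (h2 : ¬ P.vle b' b)
    (h3 : ¬ P.vle b' c) : b' ∉ P.down {a, b, c} \ {a, c} := by
  rintro ⟨h, -⟩
  rw [P.mem_down] at h
  obtain ⟨x, rfl | rfl | rfl, hx⟩ := h
  · exact h1 hx
  · exact h2 hx
  · exact h3 hx

theorem POPartition.mem_down_triple (h : P.vle b' b) (ha : b' ≠ a) (hc : b' ≠ c) :
    b' ∈ P.down {a, b, c} \ {a, c} :=
  ⟨P.mem_down.2 ⟨b, by simp, h⟩, by simp [ha, hc]⟩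

theorem RecoversPAdj.mem_E3_of_below (h : RecoversPAdj Gs P) (hne : a ≠ c)
    (hac : ¬ PAdj Gs a c) (hab : PAdj Gs a b) (hcb : PAdj Gs c b)
    (hb' : BelowCommonChild Gs a b' c) (hle : P.vle b' b) : (a, b, c) ∈ E3 Gs P := by
  have hn := hb'.not_isAncestor hne hac
  exact h.mem_E3_iff.2 ⟨hne, hab, hcb, hac, .of_belowCommonChild hb' (by simp) (by simp)
    (POPartition.mem_down_triple hle (by rintro rfl; exact hn.1 .refl)
      (by rintro rfl; exact hn.2 .refl))⟩

/-- As for `E1`, only a single moral edge can connect `a` and `c`. Its common child precedes neither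
of them, as they are not p-adjacent, and hence precedes `b`. -/
theorem mem_E3_assocPOPartition_iff : (a, b, c) ∈ E3 Gs (assocPOPartition Gs) ↔
    a ≠ c ∧ PAdj Gs a b ∧ PAdj Gs c b ∧ ¬ PAdj Gs a c ∧ BelowCommonChild Gs a b c := by
  have hrec := recoversPAdj_assocPOPartition Gs
  constructor
  · rw [hrec.mem_E3_iff]
    rintro ⟨hne, hab, hcb, hac, h⟩
    refine ⟨hne, hab, hcb, hac, ?_⟩
    have hanc : ∀ v ∈ ancestralSet Gs a c ((assocPOPartition Gs).down {a, b, c} \ {a, c}),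
        IsAncestor Gs v a ∨ IsAncestor Gs v b ∨ IsAncestor Gs v c := by
      rintro v (h1 | h1 | ⟨z, ⟨hz, -⟩, h1⟩)
      · exact Or.inl h1
      · exact Or.inr (Or.inr h1)
      · rw [POPartition.mem_down] at hz
        obtain ⟨x, rfl | rfl | rfl, hx⟩ := hz <;> rw [vle_assocPOPartition] at hx
        · exact Or.inl (h1.trans hx)
        · exact Or.inr (Or.inl (h1.trans hx))
        · exact Or.inr (Or.inr (h1.trans hx))
    have hZ : ∀ v ∈ ancestralSet Gs a c ((assocPOPartition Gs).down {a, b, c} \ {a, c}),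
        v = a ∨ v = c ∨ v ∈ (assocPOPartition Gs).down {a, b, c} \ {a, c} := by
      intro v hv
      by_cases h1 : v = a
      · exact Or.inl h1
      · by_cases h2 : v = c
        · exact Or.inr (Or.inl h2)
        · refine Or.inr (Or.inr ⟨?_, by simp [h1, h2]⟩)
          rw [POPartition.mem_down]
          simpa [vle_assocPOPartition] using hanc v hv
    obtain h1 | ⟨d, hd, h1⟩ := h.pAdj_or_commonChild hne hZ
    · exact absurd h1 hac
    · rcases hanc d hd with h2 | h2 | h2
      · exact absurd ⟨hne, Or.inr ⟨d, h1, Or.inl h2⟩⟩ hac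
      · exact ⟨d, h1, h2⟩
      · exact absurd ⟨hne, Or.inr ⟨d, h1, Or.inr h2⟩⟩ hac
  · rintro ⟨hne, hab, hcb, hac, h⟩
    exact hrec.mem_E3_of_below hne hac hab hcb h (POPartition.vle_refl _ _)

/-- If `b` is a true ancestor of `a` or `c` but `P` does not place it below them, it is not
conditioned on and connects `a` with `c`. -/
theorem RecoversPAdj.E2_subset (h : RecoversPAdj Gs P) :
    E2 Gs (assocPOPartition Gs) ⊆ E2 Gs P := by
  rintro ⟨a, b, c⟩ hm
  rw [(recoversPAdj_assocPOPartition Gs).mem_E2_iff] at hm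
  rw [h.mem_E2_iff]
  obtain ⟨hne, hab, hcb, hac, hle⟩ := hm
  refine ⟨hne, hab, hcb, hac, ?_⟩
  by_contra hc
  push Not at hc
  simp only [vle_assocPOPartition] at hle
  exact h.not_moralConn hne hac (.of_triple hab hcb.symm (by simp)
    (POPartition.notMem_down_pair hc.1 hc.2) (by simp)
    (hle.elim Or.inl fun h => Or.inr (Or.inl h)))

theorem RecoversPAdj.E3_subset (h : RecoversPAdj Gs P) :
    E3 Gs (assocPOPartition Gs) ⊆ E3 Gs P := by
  rintro ⟨a, b, c⟩ hm
  obtain ⟨hne, hab, hcb, hac, hle⟩ := mem_E3_assocPOPartition_iff.1 hm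
  exact h.mem_E3_of_below hne hac hab hcb hle (P.vle_refl b)

/-- If `P` does not place `b₁` below `b₂`, the path through `b₁` avoids `P.down {a, b₂, c}`, while
the true descendant `b₂` of `b₁` is conditioned on. This puts `(a, b₂, c)` into `E3`. -/
theorem RecoversPAdj.E4_subset (h : RecoversPAdj Gs P)
    (h2 : E2 Gs P = E2 Gs (assocPOPartition Gs)) (h3 : E3 Gs P = E3 Gs (assocPOPartition Gs)) :
    E4 Gs (assocPOPartition Gs) ⊆ E4 Gs P := by
  rintro q ⟨a, b₁, b₂, c, rfl, hd1, hd2, e1, e2, e3, e4, e5, e6, e7, e8, e9, hle⟩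
  simp only [recoversPAdj_assocPOPartition Gs _ _] at e1 e2 e3 e4 e5
  rw [← h2] at e6 e7
  rw [← h3] at e8 e9
  have hle' : IsAncestor Gs b₁ b₂ := (vle_assocPOPartition Gs).1 hle
  refine ⟨a, b₁, b₂, c, rfl, hd1, hd2, (h _ _).2 e1, (h _ _).2 e2, (h _ _).2 e3, (h _ _).2 e4,
    fun hac => e5 ((h _ _).1 hac), e6, e7, e8, e9, ?_⟩
  by_contra hc
  rw [h.mem_E2_iff] at e6
  rw [h.mem_E3_iff] at e9
  have hn : ¬ (P.vle b₁ a ∨ P.vle b₁ c) := fun h => e6 ⟨hd1.2.2, e1, e2, e5, h⟩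
  push Not at hn
  refine e9 ⟨hd1.2.2, e3, e4, e5, .of_triple e1 e2.symm (by simp)
    (POPartition.notMem_down_triple hn.1 hc hn.2) (by simp) (Or.inr (Or.inr ⟨b₂, ?_, hle'⟩))⟩
  exact POPartition.mem_down_triple (P.vle_refl _) hd2.1.symm hd2.2.1

/-- Mutual chains for the p-adjacencies of the true graph and the order of the partition. -/
abbrev POPartition.IsChain (Gs : Digraph (Fin n)) (P : POPartition n) (t : ℕ) (x : ℕ → Fin n) :
    Prop := IsMutualChain (PAdj Gs) P.vle t x

theorem isChain_assocPOPartition_iff {t : ℕ} {x : ℕ → Fin n} :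
    (assocPOPartition Gs).IsChain Gs t x ↔ IsMutualChain (PAdj Gs) (IsAncestor Gs) t x := by
  have : (assocPOPartition Gs).vle = IsAncestor Gs :=
    funext₂ fun a b => propext (vle_assocPOPartition Gs)
  unfold POPartition.IsChain
  rw [this]

theorem RecoversPAdj.mem_D_iff (h : RecoversPAdj Gs P) {t : ℕ} {x : ℕ → Fin n} :
    (fun i : Fin (t + 2) => x i) ∈ D Gs P t ↔ P.IsChain Gs t x := by
  have hone : ((1 : Fin (t + 2)) : ℕ) = 1 := by simp
  simp only [D, Set.mem_ofPred_eq, P.leMax_iff, h _ _, P.sec_eq_iff, hone, Fin.val_last,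
    Fin.val_zero, Fin.val_castSucc, Fin.val_succ]
  constructor
  · rintro ⟨h1, h2, h3, h4, h5⟩
    push Not at h5
    refine ⟨fun i j hij hj he => ?_, fun i hi => h2 ⟨i, by omega⟩, fun i j hij hj he => ?_,
      fun i h6 h7 => h4 ⟨i, by omega⟩ h6 h7, h5.1, h5.2⟩
    · have := h1 (a₁ := ⟨i, by omega⟩) (a₂ := ⟨j, by omega⟩) he
      simp only [Fin.mk.injEq] at this
      omega
    · exact h3 ⟨j, by omega⟩ ⟨i, by omega⟩ hij he.symm
  · intro hc
    refine ⟨fun i j he => ?_, fun i => hc.adj_succ i (by omega), fun i j hij he =>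
      hc.not_adj j i hij (by omega) he.symm, fun i h1 h2 => hc.equiv i h1 h2,
      fun ho => ho.elim hc.not_le_left hc.not_le_right⟩
    rcases lt_trichotomy (i : ℕ) j with h1 | h1 | h1
    · exact absurd he (hc.ne i j h1 (by omega))
    · exact Fin.ext h1
    · exact absurd he.symm (hc.ne j i h1 (by omega))

/-- Every tuple is the restriction of a sequence. -/
theorem exists_eq_restrict {t : ℕ} (a : Fin (t + 2) → Fin n) :
    ∃ x : ℕ → Fin n, a = fun i : Fin (t + 2) => x i :=
  ⟨fun i => if h : i < t + 2 then a ⟨i, h⟩ else a 0, by funext i; simp⟩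

theorem POPartition.IsChain.add_two_le {t : ℕ} {x : ℕ → Fin n} (h : P.IsChain Gs t x) :
    t + 2 ≤ n := by
  have hinj : Function.Injective fun i : Fin (t + 2) => x i := by
    intro i j he
    rcases lt_trichotomy (i : ℕ) j with h1 | h1 | h1
    · exact absurd he (h.ne i j h1 (by omega))
    · exact Fin.ext h1
    · exact absurd he.symm (h.ne j i h1 (by omega))
  simpa using Fintype.card_le_of_injective _ hinj

/-- A mutual chain of the partition is one of the true graph, if the shorter mutual chains of the
true graph are ones of the partition. -/
theorem RecoversPAdj.isChain_of_shorter (h : RecoversPAdj Gs P) {t : ℕ}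
    (hs : ∀ s, 1 ≤ s → s < t → ∀ x, (assocPOPartition Gs).IsChain Gs s x → P.IsChain Gs s x)
    {x : ℕ → Fin n} (hx : P.IsChain Gs t x) : (assocPOPartition Gs).IsChain Gs t x := by
  by_cases hU : ∃ i, 1 ≤ i ∧ i ≤ t ∧
      ¬ (IsAncestor Gs (x i) (x 0) ∨ IsAncestor Gs (x i) (x (t + 1)))
  · obtain ⟨i, hi1, hit, hi⟩ := hU
    obtain ⟨k, s, hs1, hks, -, hchain⟩ := exists_isMutualChain (adj := PAdj Gs)
      (le := (assocPOPartition Gs).vle) (POPartition.vle_refl _)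
      (fun _ _ _ => POPartition.vle_trans _)
      (U := {v | IsAncestor Gs v (x 0) ∨ IsAncestor Gs v (x (t + 1))})
      (fun u w hu hw => by
        rw [vle_assocPOPartition] at hu
        exact hw.imp (fun h => hu.trans h) (fun h => hu.trans h)) x
      (Or.inl .refl) (Or.inr .refl) (m := t + 1) (i := i) (by omega) hi hx.ne
      (fun i hi _ => hx.adj_succ i (by omega)) hx.not_adj
    rcases (show s ≤ t by omega).lt_or_eq with hst | rfl
    -- A proper subchain has at least one end among the inner terms of `x`, and these are all
    -- equivalent for `P`.
    · have hP := hs s hs1 hst _ hchain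
      rcases Nat.eq_zero_or_pos k with rfl | hk
      · refine absurd ?_ hP.not_le_right
        exact P.vle_trans (hx.equiv _ (by omega) (by omega)).1
          (hx.equiv _ (by omega) (by omega)).2
      · refine absurd ?_ hP.not_le_left
        exact P.vle_trans (hx.equiv _ (by omega) (by omega)).1
          (hx.equiv _ (by omega) (by omega)).2
    · obtain rfl : k = 0 := by omega
      simpa using hchain
  · push Not at hU
    -- If all inner terms are true ancestors of the ends, the chain itself is an open path, because
    -- `P` places none of them below the ends.
    refine absurd (MoralConn.of_path (Z := P.down {x 0, x (t + 1)} \ {x 0, x (t + 1)})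
      hx.adj_succ (fun i hi => ?_) fun i h1 h2 => ?_)
      (h.not_moralConn (hx.ne _ _ (by omega) le_rfl) ?_)
    · rcases Nat.eq_zero_or_pos i with rfl | h1
      · simp
      · rcases hi.lt_or_eq with h2 | rfl
        · have he := (hx.equiv i h1 (by omega)).2
          exact POPartition.notMem_down_pair (fun h => hx.not_le_left (P.vle_trans he h))
            (fun h => hx.not_le_right (P.vle_trans he h))
        · simp
    · exact (hU i h1 h2).imp id Or.inl
    · by_cases ht : t = 0
      · subst ht
        exact absurd (P.vle_refl _) hx.not_le_right
      · exact hx.not_adj _ _ (by omega) le_rfl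

/-- `D` is not optimized at `t = 1`; there, agreement on `E2` already settles the mutual chains. -/
theorem RecoversPAdj.isChain_one (h : RecoversPAdj Gs P)
    (h2 : E2 Gs P = E2 Gs (assocPOPartition Gs)) {x : ℕ → Fin n}
    (hx : (assocPOPartition Gs).IsChain Gs 1 x) : P.IsChain Gs 1 x := by
  have hmem : (x 0, x 1, x 2) ∉ E2 Gs P := by
    rw [h2, (recoversPAdj_assocPOPartition Gs).mem_E2_iff]
    exact fun h => h.2.2.2.2.elim hx.not_le_left hx.not_le_right
  rw [h.mem_E2_iff] at hmem
  have hn : ¬ (P.vle (x 1) (x 0) ∨ P.vle (x 1) (x 2)) := fun hc =>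
    hmem ⟨hx.ne 0 2 (by omega) (by omega), hx.adj_succ 0 (by omega),
      (hx.adj_succ 1 (by omega)).symm, hx.not_adj 0 2 (by omega) (by omega), hc⟩
  push Not at hn
  refine ⟨hx.ne, hx.adj_succ, hx.not_adj, fun i h3 h4 => ?_, hn.1, hn.2⟩
  obtain rfl : i = 1 := by omega
  exact ⟨P.vle_refl _, P.vle_refl _⟩

theorem RecoversPAdj.mem_E6_iff (h : RecoversPAdj Gs P) {t : ℕ} (ht : 1 ≤ t) {x : ℕ → Fin n}
    (hx : P.IsChain Gs t x) (h0 : PAdj Gs (x 0) b) (h1 : PAdj Gs (x (t + 1)) b)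
    (h3 : (x 0, b, x (t + 1)) ∉ E3 Gs P) :
    (⟨t, fun i : Fin (t + 2) => x i, (x 0, b, x (t + 1))⟩ :
      Σ t : ℕ, (Fin (t + 2) → Fin n) × (Fin n × Fin n × Fin n)) ∈ E6 Gs P ↔ P.vle (x 1) b := by
  have hone : ((1 : Fin (t + 2)) : ℕ) = 1 := by simp
  constructor
  · rintro ⟨t', a, b', he, -, -, -, -, -, -, -, -, hle⟩
    obtain rfl : t = t' := congrArg Sigma.fst he
    simp only [Sigma.mk.injEq, heq_eq_eq, Prod.mk.injEq, true_and] at he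
    obtain ⟨rfl, -, rfl, -⟩ := he
    simp only [hone] at hle
    exact hle
  · intro hle
    have hne := hx.ne 0 (t + 1) (by omega) le_rfl
    refine ⟨t, fun i => x i, b, rfl, ht, hx.add_two_le, ⟨h0.1, h1.1.symm, hne⟩,
      (h _ _).2 h0, (h _ _).2 h1, ?_, h3, h.mem_D_iff.2 hx, by simp only [hone]; exact hle⟩
    intro h2
    rcases (h.mem_E2_iff.1 h2).2.2.2.2 with h4 | h4
    · exact hx.not_le_left (P.vle_trans hle h4)
    · exact hx.not_le_right (P.vle_trans hle h4)

/-- The argument for `E4` with the whole chain in place of `b₁`: its inner terms are true ancestors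
of `b`, and if `P` does not place them below `b`, the chain opens and yields a triple of `E3`. -/
theorem RecoversPAdj.E6_subset (h : RecoversPAdj Gs P)
    (h3 : E3 Gs P = E3 Gs (assocPOPartition Gs))
    (hD : ∀ t, 1 ≤ t → ∀ x, (assocPOPartition Gs).IsChain Gs t x → P.IsChain Gs t x) :
    E6 Gs (assocPOPartition Gs) ⊆ E6 Gs P := by
  have hrec := recoversPAdj_assocPOPartition Gs
  rintro q ⟨t, a, b, rfl, ht, -, -, e1, e2, -, e4, e5, hle⟩
  obtain ⟨x, rfl⟩ := exists_eq_restrict a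
  have hone : ((1 : Fin (t + 2)) : ℕ) = 1 := by simp
  rw [hrec.mem_D_iff] at e5
  have hx := hD t ht x e5
  rw [hrec] at e1 e2
  rw [← h3] at e4
  simp only [hone, Fin.val_zero, Fin.val_last] at e1 e2 e4 hle ⊢
  rw [h.mem_E6_iff ht hx e1 e2 e4]
  by_contra hc
  have hne := hx.ne 0 (t + 1) (by omega) le_rfl
  refine e4 (h.mem_E3_iff.2 ⟨hne, e1, e2, hx.not_adj _ _ (by omega) le_rfl,
    .of_path hx.adj_succ (fun i hi => ?_) fun i h1 h2 => ?_⟩)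
  · rcases Nat.eq_zero_or_pos i with rfl | h1
    · simp
    · rcases hi.lt_or_eq with h2 | rfl
      · have he := (hx.equiv i h1 (by omega)).2
        exact POPartition.notMem_down_triple (fun h => hx.not_le_left (P.vle_trans he h))
          (fun h => hc (P.vle_trans he h)) (fun h => hx.not_le_right (P.vle_trans he h))
      · simp
  · exact Or.inr (Or.inr ⟨b, POPartition.mem_down_triple (P.vle_refl _) e1.1.symm e2.1.symm,
      (vle_assocPOPartition Gs).1 (POPartition.vle_trans _ (e5.equiv i h1 h2).1 hle)⟩)

end Partitions

/-! ### Successive optimization fixes the score sets -/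

section Optimality

/-- A least set for inclusion is the only one of minimal size, so every minimizer has the same set
and not merely the same cardinality. -/
theorem mem_argmin_ncard {α β : Type*} {S : Set α} {F : α → Set β} {x : α} (hx : x ∈ S)
    (hfin : ∀ y, (F y).Finite) (h : ∀ y ∈ S, F x ⊆ F y) :
    x ∈ argmin S (fun y => (F y).ncard) ∧
      ∀ y ∈ argmin S (fun y => (F y).ncard), y ∈ S ∧ F y = F x :=
  ⟨⟨hx, fun y hy => Set.ncard_le_ncard (h y hy) (hfin y)⟩, fun y hy =>
    ⟨hy.1, (Set.eq_of_subset_of_ncard_le (h y hy.1) (hy.2 x hx) (hfin y)).symm⟩⟩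

theorem mem_argmax_ncard {α β : Type*} {S : Set α} {F : α → Set β} {x : α} (hx : x ∈ S)
    (hfin : ∀ y, (F y).Finite) (h : ∀ y ∈ S, F y ⊆ F x) :
    x ∈ argmax S (fun y => (F y).ncard) ∧
      ∀ y ∈ argmax S (fun y => (F y).ncard), y ∈ S ∧ F y = F x :=
  ⟨⟨hx, fun y hy => Set.ncard_le_ncard (h y hy) (hfin x)⟩, fun y hy =>
    ⟨hy.1, Set.eq_of_subset_of_ncard_le (h y hy.1) (hy.2 x hx) (hfin x)⟩⟩

variable {n : ℕ} (Gs : Digraph (Fin n))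

theorem S1_spec : assocPOPartition Gs ∈ S1 Gs ∧ ∀ P ∈ S1 Gs, RecoversPAdj Gs P := by
  obtain ⟨h1, h2⟩ := mem_argmin_ncard (S := Set.univ) (F := E1 Gs)
    (Set.mem_univ (assocPOPartition Gs)) (fun _ => Set.toFinite _) fun P _ => by
      rintro ⟨a, b⟩ hab
      exact mem_E1_of_pAdj (mem_E1_assocPOPartition_iff.1 hab)
  exact ⟨h1, fun P hP a b => by rw [(h2 P hP).2]; exact mem_E1_assocPOPartition_iff⟩

theorem S2_spec : assocPOPartition Gs ∈ S2 Gs ∧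
    ∀ P ∈ S2 Gs, RecoversPAdj Gs P ∧ E2 Gs P = E2 Gs (assocPOPartition Gs) := by
  obtain ⟨h1, h2⟩ := mem_argmin_ncard (S := S1 Gs) (F := E2 Gs) (S1_spec Gs).1
    (fun _ => Set.toFinite _) fun P hP => ((S1_spec Gs).2 P hP).E2_subset
  exact ⟨h1, fun P hP => ⟨(S1_spec Gs).2 P (h2 P hP).1, (h2 P hP).2⟩⟩

theorem S3_spec : assocPOPartition Gs ∈ S3 Gs ∧ ∀ P ∈ S3 Gs, RecoversPAdj Gs P ∧
    E2 Gs P = E2 Gs (assocPOPartition Gs) ∧ E3 Gs P = E3 Gs (assocPOPartition Gs) := by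
  obtain ⟨h1, h2⟩ := mem_argmin_ncard (S := S2 Gs) (F := E3 Gs) (S2_spec Gs).1
    (fun _ => Set.toFinite _) fun P hP => ((S2_spec Gs).2 P hP).1.E3_subset
  refine ⟨h1, fun P hP => ?_⟩
  obtain ⟨h3, h4⟩ := (S2_spec Gs).2 P (h2 P hP).1
  exact ⟨h3, h4, (h2 P hP).2⟩

/-- The pairs of `E4` recur in `E6` at `t = 1`, so it suffices here that the associated partition
remains a minimizer. -/
theorem S4_spec : assocPOPartition Gs ∈ S4 Gs ∧ ∀ P ∈ S4 Gs, RecoversPAdj Gs P ∧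
    E2 Gs P = E2 Gs (assocPOPartition Gs) ∧ E3 Gs P = E3 Gs (assocPOPartition Gs) := by
  obtain ⟨h1, h2⟩ := mem_argmin_ncard (S := S3 Gs) (F := E4 Gs) (S3_spec Gs).1
    (fun _ => Set.toFinite _) fun P hP =>
      let ⟨h3, h4, h5⟩ := (S3_spec Gs).2 P hP
      h3.E4_subset h4 h5
  exact ⟨h1, fun P hP => (S3_spec Gs).2 P (h2 P hP).1⟩

theorem isChain_iff_of_D_eq {P : POPartition n} (h : RecoversPAdj Gs P) {t : ℕ}
    (hD : D Gs P t = D Gs (assocPOPartition Gs) t) (x : ℕ → Fin n) :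
    P.IsChain Gs t x ↔ (assocPOPartition Gs).IsChain Gs t x := by
  rw [← h.mem_D_iff, hD, (recoversPAdj_assocPOPartition Gs).mem_D_iff]

theorem S5_spec (t : ℕ) : assocPOPartition Gs ∈ S5 Gs t ∧ ∀ P ∈ S5 Gs t, P ∈ S4 Gs ∧
    ∀ s, 1 ≤ s → s ≤ t → ∀ x, P.IsChain Gs s x ↔ (assocPOPartition Gs).IsChain Gs s x := by
  induction t with
  | zero => exact ⟨(S4_spec Gs).1, fun P hP => ⟨hP, fun s _ _ => by omega⟩⟩
  | succ t ih =>
    rcases t with _ | t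
    · refine ⟨(S4_spec Gs).1, fun P hP => ⟨hP, fun s h1 h2 x => ?_⟩⟩
      obtain rfl : s = 1 := by omega
      obtain ⟨h3, h4, -⟩ := (S4_spec Gs).2 P hP
      exact ⟨h3.isChain_of_shorter fun s _ _ => by omega, h3.isChain_one h4⟩
    · obtain ⟨h1, h2⟩ := mem_argmax_ncard (S := S5 Gs (t + 1)) (F := fun P => D Gs P (t + 2)) ih.1
        (fun _ => Set.toFinite _) fun P hP a ha => by
          obtain ⟨hP4, hlt⟩ := ih.2 P hP
          have h3 := ((S4_spec Gs).2 P hP4).1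
          obtain ⟨x, rfl⟩ := exists_eq_restrict a
          rw [(recoversPAdj_assocPOPartition Gs).mem_D_iff]
          exact h3.isChain_of_shorter (fun s hs1 hs2 x => (hlt s hs1 (by omega) x).2)
            (h3.mem_D_iff.1 ha)
      refine ⟨h1, fun P hP => ?_⟩
      obtain ⟨hP4, hlt⟩ := ih.2 P (h2 P hP).1
      refine ⟨hP4, fun s hs1 hs2 x => ?_⟩
      rcases hs2.lt_or_eq with hs3 | rfl
      · exact hlt s hs1 (by omega) x
      · exact isChain_iff_of_D_eq Gs ((S4_spec Gs).2 P hP4).1 (h2 P hP).2 x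

theorem isChain_iff_of_mem_S5 {P : POPartition n} (hP : P ∈ S5 Gs (n - 2)) (t : ℕ) (ht : 1 ≤ t)
    (x : ℕ → Fin n) : P.IsChain Gs t x ↔ (assocPOPartition Gs).IsChain Gs t x := by
  by_cases htn : t ≤ n - 2
  · exact ((S5_spec Gs (n - 2)).2 P hP).2 t ht htn x
  -- A chain has `t + 2` distinct vertices, so there is none with `t > n - 2`.
  · constructor <;> intro h <;> have := h.add_two_le <;> omega

theorem S6_spec (P : POPartition n) (hP : P ∈ S6 Gs) : RecoversPAdj Gs P ∧
    E3 Gs P = E3 Gs (assocPOPartition Gs) ∧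
    (∀ t, 1 ≤ t → ∀ x, P.IsChain Gs t x ↔ (assocPOPartition Gs).IsChain Gs t x) ∧
    E6 Gs P = E6 Gs (assocPOPartition Gs) := by
  obtain ⟨-, h2⟩ := mem_argmin_ncard (S := S5 Gs (n - 2)) (F := E6 Gs) (S5_spec Gs (n - 2)).1
    (fun _ => E6_finite Gs _) fun P hP =>
      let ⟨h3, _, h5⟩ := (S4_spec Gs).2 P ((S5_spec Gs (n - 2)).2 P hP).1
      h3.E6_subset h5 fun t ht x => (isChain_iff_of_mem_S5 Gs hP t ht x).2
  obtain ⟨h3, h6⟩ := h2 P hP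
  obtain ⟨h4, -, h5⟩ := (S4_spec Gs).2 P ((S5_spec Gs (n - 2)).2 P h3).1
  exact ⟨h4, h5, isChain_iff_of_mem_S5 Gs h3, h6⟩

end Optimality

/-! ### From the four properties to compatibility -/

section Properties

variable {n : ℕ} {Gs G : Digraph (Fin n)} {P : POPartition n}

theorem hasProperties_assocPOPartition (Gs : Digraph (Fin n)) :
    HasProperties Gs (assocPOPartition Gs) Gs where
  pAdj_iff _ _ := mem_E1_assocPOPartition_iff.symm
  ancestor_iff _ _ := (vle_assocPOPartition Gs).symm
  commonChild a b c h hmin := by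
    obtain ⟨hne, hab, hcb, hac, d, hd, hdb⟩ := mem_E3_assocPOPartition_iff.1 h
    have hbd : BelowCommonChild Gs a d c := ⟨d, hd, .refl⟩
    have hn := hbd.not_isAncestor hne hac
    have hE3 : (a, d, c) ∈ E3 Gs (assocPOPartition Gs) := mem_E3_assocPOPartition_iff.2
      ⟨hne, ⟨by rintro rfl; exact hn.1 .refl, Or.inl (Or.inl hd.1)⟩,
        ⟨by rintro rfl; exact hn.2 .refl, Or.inl (Or.inl hd.2)⟩, hac, hbd⟩
    refine ⟨d, POPartition.mem_iff_sec_eq _ |>.2 ?_, hd⟩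
    by_contra hc
    exact hmin d ((vle_assocPOPartition Gs).2 hdb) hc hE3
  noCommonChild a b c hne hab hcb hac _ h3 := by
    rintro ⟨d, hd, hcd⟩
    rw [mem_E1_assocPOPartition_iff] at hab hcb hac
    have hdb := ((POPartition.sec_eq_iff _).1 ((POPartition.mem_iff_sec_eq _).1 hd)).1
    exact h3 (mem_E3_assocPOPartition_iff.2
      ⟨hne, hab, hcb, hac, d, hcd, (vle_assocPOPartition Gs).1 hdb⟩)

namespace HasProperties

theorem vle_iff (h : HasProperties Gs P G) {a b : Fin n} : P.vle a b ↔ IsAncestor G a b :=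
  (h.ancestor_iff a b).symm

/-- The vertices below a common child in `G` are described by `E3`. -/
theorem belowCommonChild_iff (h : HasProperties Gs P G) (hrec : RecoversPAdj Gs P)
    (h3 : E3 Gs P = E3 Gs (assocPOPartition Gs)) {a b c : Fin n} (hne : a ≠ c)
    (hac : ¬ PAdj Gs a c) (hab : PAdj Gs a b) (hcb : PAdj Gs c b) :
    BelowCommonChild G a b c ↔ (a, b, c) ∈ E3 Gs P := by
  have hadj : ∀ a b, PAdj G a b ↔ PAdj Gs a b := fun a b =>
    (h.pAdj_iff a b).trans (hrec a b)
  have hacG : ¬ PAdj G a c := fun h' => hac ((hadj a c).1 h')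
  constructor
  · rintro ⟨d, hd, hdb⟩
    have hbd : BelowCommonChild G a d c := ⟨d, hd, .refl⟩
    have hn := hbd.not_isAncestor hne hacG
    have had : PAdj Gs a d := (hadj a d).1
      ⟨by rintro rfl; exact hn.1 .refl, Or.inl (Or.inl hd.1)⟩
    have hcd : PAdj Gs c d := (hadj c d).1
      ⟨by rintro rfl; exact hn.2 .refl, Or.inl (Or.inl hd.2)⟩
    have hE3 : (a, d, c) ∈ E3 Gs P := by
      by_contra hc
      refine h.noCommonChild a d c hne ((hrec _ _).2 had) ((hrec _ _).2 hcd)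
        (fun h' => hac ((hrec _ _).1 h')) ?_ hc ⟨d, P.mem_iff_sec_eq.2 rfl, hd⟩
      rw [P.leMax_iff, h.vle_iff, h.vle_iff]
      exact fun h' => h'.elim hn.1 hn.2
    -- Through the associated partition, `E3` yields a common child in the true graph above `d`, and
    -- conditioning on `d` below `b` then connects `a` and `c`.
    rw [h3, mem_E3_assocPOPartition_iff] at hE3
    exact hrec.mem_E3_of_below hne hac hab hcb hE3.2.2.2.2 (h.vle_iff.2 hdb)
  · intro hE3
    -- The fewest predecessors make the section of `b'` minimal, as the third property requires.
    obtain ⟨b', ⟨hb'b, hb'E⟩, hmin⟩ := Set.exists_min_image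
      {b' | P.vle b' b ∧ (a, b', c) ∈ E3 Gs P} (fun b' => {v | P.vle v b'}.ncard)
      (Set.toFinite _) ⟨b, P.vle_refl b, hE3⟩
    obtain ⟨d, hd, hcd⟩ := h.commonChild a b' c hb'E fun b'' hle hsec hE => by
      have hsub : {v | P.vle v b''} ⊆ {v | P.vle v b'} := fun v hv => P.vle_trans hv hle
      have heq := Set.eq_of_subset_of_ncard_le hsub (hmin b'' ⟨P.vle_trans hle hb'b, hE⟩)
        (Set.toFinite _)
      have : b' ∈ {v | P.vle v b''} := heq ▸ P.vle_refl b'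
      exact hsec (P.sec_eq_iff.2 ⟨hle, this⟩)
    have hdb' := (P.sec_eq_iff.1 (P.mem_iff_sec_eq.1 hd)).1
    exact ⟨d, hcd, h.vle_iff.1 (P.vle_trans hdb' hb'b)⟩

theorem compatible (h : HasProperties Gs P G) (hP : P ∈ S6 Gs) : Compatible G Gs := by
  obtain ⟨hrec, h3, hD, h6⟩ := S6_spec Gs P hP
  have hrecs := recoversPAdj_assocPOPartition Gs
  have hadj : ∀ a b, PAdj G a b ↔ PAdj Gs a b := fun a b =>
    (h.pAdj_iff a b).trans (hrec a b)
  have hadj' : PAdj G = PAdj Gs := funext₂ fun a b => propext (hadj a b)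
  have hanc : IsAncestor G = P.vle := funext₂ fun a b => propext h.vle_iff.symm
  constructor
  · exact hadj
  · intro a b c hne hac hab hcb
    rw [hadj] at hac hab hcb
    rw [h.belowCommonChild_iff hrec h3 hne hac hab hcb, h3, mem_E3_assocPOPartition_iff]
    exact ⟨fun h => h.2.2.2.2, fun h => ⟨hne, hab, hcb, hac, h⟩⟩
  · intro t ht x
    rw [hadj', hanc, ← isChain_assocPOPartition_iff]
    exact hD t ht x
  · intro t ht x b hx h0 h1 hb
    rw [hadj', hanc] at hx
    rw [hadj] at h0 h1
    have hE3 : (x 0, b, x (t + 1)) ∉ E3 Gs P := fun h' =>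
      hb ((h.belowCommonChild_iff hrec h3 (hx.ne _ _ (by omega) le_rfl)
        (hx.not_adj _ _ (by omega) le_rfl) h0 h1).2 h')
    rw [hanc, ← hrec.mem_E6_iff ht hx h0 h1 hE3, h6,
      hrecs.mem_E6_iff ht ((hD t ht x).1 hx) h0 h1 (h3 ▸ hE3), vle_assocPOPartition]

end HasProperties

end Properties

end CyclicCausal

theorem mainTheorem2 (n : ℕ) (Gs : Digraph (Fin n)) :
    (∀ P ∈ CyclicCausal.S6 Gs, ∀ G : Digraph (Fin n),
      CyclicCausal.HasProperties Gs P G → CyclicCausal.MarkovEquivalent G Gs) ∧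
    CyclicCausal.HasProperties Gs (CyclicCausal.assocPOPartition Gs) Gs :=
  ⟨fun _ hP _ h => (h.compatible hP).markovEquivalent,
    CyclicCausal.hasProperties_assocPOPartition Gs⟩
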